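/- Let $M$ be a compact smooth ($C^\infty$, finite-dimensional, boundaryless) Riemannian manifold with Riemannian distance $\operatorname{dist}$. Let $R : TM \to M$ be a $C^2$ retraction, that is, a $C^2$ map with $R(x,0)=x$ for all $x \in M$ and such that the differential of $d \mapsto R(x,d)$ at $0 \in T_xM$ is the identity of $T_xM$. Let $f : M \to \mathbb{R}$ be continuously differentiable, with Riemannian gradient $\operatorname{grad} f$, and suppose that $\operatorname{grad} f$ is Lipschitz with respect to parallel transport: there is $L_f > 0$ such that, for all $x, y \in M$ joined by a minimizing geodesic, $$\|\Gamma_x^y \operatorname{grad} f(x) - \operatorname{grad} f(y)\|_y \le L_f \operatorname{dist}(x,y),$$ where $\Gamma_x^y$ denotes the parallel transport from $T_xM$ to $T_yM$ of the Levi-Civita connection along a minimizing geodesic from $x$ to $y$ (any of them, if there are several). Then there is a constant $L > 0$ such that $$f(R(x,d)) \le f(x) + \langle \operatorname{grad} f(x), d\rangle_x + L\|d\|_x^2 \qquad \text{for all } x \in M \text{ and } d \in T_xM.$$ -/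

import Mathlib

open Set Bundle
open scoped Manifold ContDiff

noncomputable section

namespace RiemannianDescent

section

variable {E : Type*} [NormedAddCommGroup E] [NormedSpace ℝ E]
  {M : Type*} [TopologicalSpace M] [ChartedSpace E M]

/-- The velocity `γ'(t)` of a curve `γ : [0, 1] → M` (one-sided at the endpoints). -/
def velocity (γ : ℝ → M) (t : ℝ) : TangentSpace 𝓘(ℝ, E) (γ t) :=
  mfderivWithin 𝓘(ℝ, ℝ) 𝓘(ℝ, E) γ (Icc 0 1) t (1 : ℝ)

/-- The coordinates, in the chart at `x₀`, of a vector field `V` along the curve `γ`. -/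
def coordField (x₀ : M) (γ : ℝ → M) (V : ∀ t : ℝ, TangentSpace 𝓘(ℝ, E) (γ t)) (t : ℝ) : E :=
  mfderiv 𝓘(ℝ, E) 𝓘(ℝ, E) (extChartAt 𝓘(ℝ, E) x₀) (γ t) (V t)

variable [RiemannianBundle (fun x : M ↦ TangentSpace 𝓘(ℝ, E) x)]

/-- The Riemannian metric in the chart at `x₀`: the value `g_y(u, v)` at the coordinate
point `y ∈ E` on the coordinate vectors `u, v ∈ E`. -/
def coordMetric (x₀ : M) (y u v : E) : ℝ :=
  inner ℝ
    (mfderiv 𝓘(ℝ, E) 𝓘(ℝ, E) (extChartAt 𝓘(ℝ, E) x₀).symm y u :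
      TangentSpace 𝓘(ℝ, E) ((extChartAt 𝓘(ℝ, E) x₀).symm y))
    (mfderiv 𝓘(ℝ, E) 𝓘(ℝ, E) (extChartAt 𝓘(ℝ, E) x₀).symm y v :
      TangentSpace 𝓘(ℝ, E) ((extChartAt 𝓘(ℝ, E) x₀).symm y))

/-- The Christoffel symbol of the first kind of the Levi-Civita connection in the chart at `x₀`,
`Γ_y(u, v; z) = g_y(Γ_y(u, v), z) = (D_u g(v, z) + D_v g(u, z) - D_z g(u, v)) / 2`. -/
def christoffel (x₀ : M) (y u v z : E) : ℝ :=
  (fderiv ℝ (fun p : E ↦ coordMetric x₀ p v z) y u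
    + fderiv ℝ (fun p : E ↦ coordMetric x₀ p u z) y v
    - fderiv ℝ (fun p : E ↦ coordMetric x₀ p u v) y z) / 2

/-- The vector field `V` along the curve `γ : [0, 1] → M` is parallel for the Levi-Civita
connection: at each time the covariant derivative of `V` along `γ` vanishes, that is, in local
coordinates `w' + Γ_c(c', w) = 0`, where `c` and `w` are the coordinates of `γ` and `V`; the
equation is paired with an arbitrary coordinate vector `z` by means of the metric. Its validity
does not depend on the chart around `γ t` in which it is written. -/
def IsParallelAlong (γ : ℝ → M) (V : ∀ t : ℝ, TangentSpace 𝓘(ℝ, E) (γ t)) : Prop :=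
  ∀ t ∈ Icc (0 : ℝ) 1, ∃ x₀ : M, γ t ∈ (extChartAt 𝓘(ℝ, E) x₀).source ∧
    ∃ c' w' : E,
      HasDerivWithinAt (fun s ↦ extChartAt 𝓘(ℝ, E) x₀ (γ s)) c' (Icc 0 1) t ∧
      HasDerivWithinAt (coordField x₀ γ V) w' (Icc 0 1) t ∧
      ∀ z : E, coordMetric x₀ (extChartAt 𝓘(ℝ, E) x₀ (γ t)) w' z
        + christoffel x₀ (extChartAt 𝓘(ℝ, E) x₀ (γ t)) c' (coordField x₀ γ V t) z = 0

/-- `γ : [0, 1] → M` is a geodesic: a `C^1` curve whose velocity is (differentiable and) parallel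
along it. -/
def IsGeodesic (γ : ℝ → M) : Prop :=
  ContMDiffOn 𝓘(ℝ, ℝ) 𝓘(ℝ, E) 1 γ (Icc 0 1) ∧ IsParallelAlong (E := E) γ (velocity γ)

/-- `w` is the parallel transport of `v` along the curve `γ : [0, 1] → M`, from `γ 0`
to `γ 1`. -/
def IsParallelTransport (γ : ℝ → M) (v : TangentSpace 𝓘(ℝ, E) (γ 0))
    (w : TangentSpace 𝓘(ℝ, E) (γ 1)) : Prop :=
  ∃ V : ∀ t : ℝ, TangentSpace 𝓘(ℝ, E) (γ t), IsParallelAlong γ V ∧ V 0 = v ∧ V 1 = w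

/-- The Riemannian gradient: `grad f(x)` is the tangent vector at `x` that represents the
differential of `f` at `x`. -/
def riemannianGradient [FiniteDimensional ℝ E] (f : M → ℝ) (x : M) : TangentSpace 𝓘(ℝ, E) x :=
  haveI : FiniteDimensional ℝ (TangentSpace 𝓘(ℝ, E) x) := inferInstanceAs (FiniteDimensional ℝ E)
  haveI : CompleteSpace (TangentSpace 𝓘(ℝ, E) x) := FiniteDimensional.complete ℝ _
  (InnerProductSpace.toDual ℝ (TangentSpace 𝓘(ℝ, E) x)).symm
    (mfderiv 𝓘(ℝ, E) 𝓘(ℝ, ℝ) f x : TangentSpace 𝓘(ℝ, E) x →L[ℝ] ℝ)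

theorem inner_riemannianGradient [FiniteDimensional ℝ E] (f : M → ℝ) (x : M)
    (v : TangentSpace 𝓘(ℝ, E) x) :
    inner ℝ (riemannianGradient f x) v
      = (mfderiv 𝓘(ℝ, E) 𝓘(ℝ, ℝ) f x : TangentSpace 𝓘(ℝ, E) x →L[ℝ] ℝ) v := by
  have : FiniteDimensional ℝ (TangentSpace 𝓘(ℝ, E) x) := inferInstanceAs (FiniteDimensional ℝ E)
  have : CompleteSpace (TangentSpace 𝓘(ℝ, E) x) := FiniteDimensional.complete ℝ _
  exact InnerProductSpace.toDual_symm_apply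

end

section

variable {E : Type*} [NormedAddCommGroup E] [NormedSpace ℝ E]
  {M : Type*} [EMetricSpace M] [ChartedSpace E M]
  [RiemannianBundle (fun x : M ↦ TangentSpace 𝓘(ℝ, E) x)]

/-- `γ : [0, 1] → M` is a minimizing geodesic: its length is the distance of its endpoints. -/
def IsMinimizingGeodesic (γ : ℝ → M) : Prop :=
  IsGeodesic (E := E) γ ∧ Manifold.pathELength 𝓘(ℝ, E) γ 0 1 = edist (γ 0) (γ 1)

/-- The gradient of `f` is `K`-Lipschitz with respect to parallel transport: for all points
`x = γ 0` and `y = γ 1` joined by a minimizing geodesic `γ`, the parallel transport `w` of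
`grad f(x)` along `γ` satisfies `‖w - grad f(y)‖ ≤ K dist(x, y)`. -/
def GradientLipschitzWith [FiniteDimensional ℝ E] (K : ℝ) (f : M → ℝ) : Prop :=
  ∀ γ : ℝ → M, IsMinimizingGeodesic (E := E) γ →
    ∀ w : TangentSpace 𝓘(ℝ, E) (γ 1), IsParallelTransport γ (riemannianGradient f (γ 0)) w →
      ‖w - riemannianGradient f (γ 1)‖ ≤ K * (edist (γ 0) (γ 1)).toReal

end

section

variable {E : Type*} [NormedAddCommGroup E] [NormedSpace ℝ E]
  {M : Type*} [TopologicalSpace M] [ChartedSpace E M] [IsManifold 𝓘(ℝ, E) ∞ M]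

/-- A `C^k` retraction `R : TM → M`: `R(x, 0) = x`, and the differential of `v ↦ R(x, v)` at the
origin of `T_x M` is the identity. -/
structure IsRetraction (k : ℕ∞) (R : TangentBundle 𝓘(ℝ, E) M → M) : Prop where
  contMDiff : ContMDiff 𝓘(ℝ, E).tangent 𝓘(ℝ, E) k R
  map_zero : ∀ x : M, R ⟨x, 0⟩ = x
  hasMFDerivAt : ∀ x : M, HasMFDerivAt 𝓘(ℝ, E) 𝓘(ℝ, E) (fun v : E ↦ R ⟨x, v⟩) 0
    (ContinuousLinearMap.id ℝ E)

end

end RiemannianDescent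

end

/-!
The differential of `f ∘ R` on a tangent vector `d` at `x` is compared with that of `f` along the
geodesic `γ` of initial velocity `d`. Along a short minimizing geodesic the inner product of two
parallel fields is constant, so the hypothesis on `grad f`, paired with the (parallel) velocity,
bounds the increase of `(f ∘ γ)'` by `Lf ‖d‖ ^ 2`; the mean value theorem, applied together with the
hypothesis on the restriction of `γ` to `[0, s]`, gives `f (γ 1) ≤ f x + ⟨grad f x, d⟩ + Lf ‖d‖ ^ 2`
(`geodesic_descent`). In a chart both `R (x, d)` and `γ 1` are `x + d + O(‖d‖ ^ 2)`, and `f` is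
Lipschitz there since it is `C^1`, so replacing `γ 1` by `R (x, d)` costs only `O(‖d‖ ^ 2)`
(`eventually_descent_chart`). Surjectivity of the exponential map and its smoothness are not needed.
Compactness makes the constants uniform for `‖d‖ < r`. For `‖d‖ ≥ r` the function `f` is bounded,
and the inequality for small vectors, rescaled, also bounds the gradient.

Since the hypothesis concerns minimizing geodesics, the main point is that short geodesics minimize
(`isMinimizingGeodesic_symm_comp`). This is proved without the Gauss lemma. For a geodesic `c` of
velocity `u` and a competitor `b` of the same endpoints, of speed `n` and parametrized by a time
change `φ` of `c` of derivative `q`, put `h = b - c ∘ φ`. The first variation formula makes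
`n ^ 2 / q` equal to `q g(u, u) + (2 g(u, h))'` plus terms of second order in `(h, h')`. When `u` is small
these are bounded below by the derivative of `-m φ g(h, h)`, a pointwise form of the Poincaré
inequality (`MetricBounds.energy_ineq`). As `h` vanishes at both ends, integrating this with `q`
nearly proportional to `n` shows that `b` is at least as long as `c`
(`MetricBounds.geodesic_minimizes`). A competitor shorter than `c` starts near the centre of the
chart and is too short to leave it.

Geodesics and parallel transport exist by the Picard-Lindelöf theorem in a chart
(`exists_geodesic`, `exists_parallelField`).
-/

noncomputable section

set_option maxSynthPendingDepth 3

namespace RiemannianDescent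

/-! ### Parallel fields and minimization by geodesics in coordinates -/

section Coordinates

variable {E : Type*} [NormedAddCommGroup E] [NormedSpace ℝ E]

/-- The Christoffel symbol of the first kind `Γ_y(u, v; z)` of a metric `G` given on a vector
space. -/
def christoffelForm (G : E → E →L[ℝ] E →L[ℝ] ℝ) (y u v z : E) : ℝ :=
  (fderiv ℝ G y u v z + fderiv ℝ G y v u z - fderiv ℝ G y z u v) / 2

/-- The vector field `w` is parallel, for the metric `G`, along a curve `c : [0, 1] → E` of
velocity `u`. The curve is a geodesic when `u` itself is parallel. -/
def IsParallelField (G : E → E →L[ℝ] E →L[ℝ] ℝ) (c u w : ℝ → E) : Prop :=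
  ∀ t ∈ Icc (0 : ℝ) 1, ∃ w' : E, HasDerivWithinAt w w' (Icc 0 1) t ∧
    ∀ z : E, G (c t) w' z + christoffelForm G (c t) (u t) (w t) z = 0

/-- `G` is a metric on `B`, bounded below by `lam` and above by `K`, whose derivative is bounded by
`K`, with first and second order Taylor estimates of constant `K`. One constant `K` serves for all
upper bounds. -/
structure MetricBounds (G : E → E →L[ℝ] E →L[ℝ] ℝ) (B : Set E) (lam K : ℝ) : Prop where
  lam_pos : 0 < lam
  pos : 0 < K
  symm : ∀ y ∈ B, ∀ u v, G y u v = G y v u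
  lower : ∀ y ∈ B, ∀ v, lam * ‖v‖ ^ 2 ≤ G y v v
  norm_le : ∀ y ∈ B, ‖G y‖ ≤ K
  differentiableAt : ∀ y ∈ B, DifferentiableAt ℝ G y
  norm_fderiv_le : ∀ y ∈ B, ‖fderiv ℝ G y‖ ≤ K
  lipschitz : ∀ y ∈ B, ∀ x ∈ B, ‖G x - G y‖ ≤ K * ‖x - y‖
  taylor : ∀ y ∈ B, ∀ x ∈ B, ‖G x - G y - fderiv ℝ G y (x - y)‖ ≤ K * ‖x - y‖ ^ 2

variable {G : E → E →L[ℝ] E →L[ℝ] ℝ} {B : Set E} {lam K : ℝ}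

/-- Openness of `B` is needed to differentiate the symmetry, which is assumed on `B` only. -/
lemma MetricBounds.fderiv_symm (hG : MetricBounds G B lam K) (hB : IsOpen B) {y : E} (hy : y ∈ B)
    (z u v : E) : fderiv ℝ G y z u v = fderiv ℝ G y z v u := by
  have key : ∀ a b : E, HasFDerivAt (fun x ↦ G x a b)
      (((ContinuousLinearMap.apply ℝ ℝ b).comp (ContinuousLinearMap.apply ℝ (E →L[ℝ] ℝ) a)).comp
        (fderiv ℝ G y)) y := fun a b ↦
    (((ContinuousLinearMap.apply ℝ ℝ b).comp
      (ContinuousLinearMap.apply ℝ (E →L[ℝ] ℝ) a)).hasFDerivAt).comp y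
        (hG.differentiableAt y hy).hasFDerivAt
  have heq : (fun x ↦ G x u v) =ᶠ[nhds y] fun x ↦ G x v u := by
    filter_upwards [hB.mem_nhds hy] with x hx using hG.symm x hx u v
  have := (key u v).unique ((key v u).congr_of_eventuallyEq heq)
  simpa using congrArg (fun T : E →L[ℝ] ℝ ↦ T z) this

/-- The inner product of two parallel fields is constant. -/
lemma IsParallelField.inner_const (hG : MetricBounds G B lam K) (hB : IsOpen B) {c u v w : ℝ → E}
    (hc : ∀ t ∈ Icc (0 : ℝ) 1, HasDerivWithinAt c (u t) (Icc 0 1) t)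
    (hcB : ∀ t ∈ Icc (0 : ℝ) 1, c t ∈ B)
    (hv : IsParallelField G c u v) (hw : IsParallelField G c u w) {t : ℝ}
    (ht : t ∈ Icc (0 : ℝ) 1) : G (c t) (v t) (w t) = G (c 0) (v 0) (w 0) := by
  have key : ∀ t ∈ Icc (0 : ℝ) 1,
      HasDerivWithinAt (fun t ↦ G (c t) (v t) (w t)) 0 (Icc 0 1) t := by
    intro t ht
    obtain ⟨v', hv', ev⟩ := hv t ht
    obtain ⟨w', hw', ew⟩ := hw t ht
    have h := (((hG.differentiableAt _ (hcB t ht)).hasFDerivAt.comp_hasDerivWithinAt t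
      (hc t ht)).clm_apply hv').clm_apply hw'
    refine h.congr_deriv ?_
    have e1 := ev (w t)
    have e2 := ew (v t)
    have s1 := hG.symm _ (hcB t ht) w' (v t)
    have s2 := hG.fderiv_symm hB (hcB t ht) (u t) (v t) (w t)
    have s3 := hG.fderiv_symm hB (hcB t ht) (v t) (u t) (w t)
    have s4 := hG.fderiv_symm hB (hcB t ht) (w t) (u t) (v t)
    simp only [christoffelForm] at e1 e2

    simp only [_root_.add_apply, Function.comp_apply]
    linarith
  refine constant_of_derivWithin_zero (fun t ht ↦ (key t ht).differentiableWithinAt)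
    (fun t ht ↦ (key t ⟨ht.1, ht.2.le⟩).derivWithin ?_) t ht
  exact uniqueDiffOn_Icc zero_lt_one t ⟨ht.1, ht.2.le⟩

/-- The pointwise estimate behind the minimizing property: `h` is the displacement from the
geodesic to a competitor, `k` its derivative, `q` the speed of the time change, and `m s` the
value of the linear weight. The smallness of `m` makes the quadratic form in `q ‖h‖` and `‖k‖` that
remains after estimating every term nonnegative. -/
lemma MetricBounds.energy_ineq (hG : MetricBounds G B lam K) {x y : E} (hx : x ∈ B) (hy : y ∈ B)
    {u k : E} {q s m : ℝ} (hq : 0 ≤ q) (hs : s ∈ Icc (0 : ℝ) 1) (hm : 0 ≤ m)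
    (hmK : m * (4 * K ^ 2 + 2 * K * lam) ≤ lam ^ 2) (hu : ‖u‖ ≤ m) :
    q ^ 2 * G y u u + q * (q * fderiv ℝ G y (x - y) u u + 2 * G y u k
      - m * q * G y (x - y) (x - y)
      - m * s * (q * fderiv ℝ G y u (x - y) (x - y) + 2 * G y (x - y) k))
    ≤ G x (k + q • u) (k + q • u) := by
  set h := x - y with hh
  have hK := hG.pos
  have hlam := hG.lam_pos
  have b3 : ∀ (A : E →L[ℝ] E →L[ℝ] ℝ) (C : ℝ) (a b : E), ‖A‖ ≤ C → |A a b| ≤ C * ‖a‖ * ‖b‖ := by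
    intro A C a b hA
    have := A.le_opNorm₂ a b
    rw [Real.norm_eq_abs] at this
    exact this.trans (by gcongr)
  have i1 := hG.lower x hx k
  have i2 := abs_le.1 (b3 _ _ u k (hG.lipschitz y hy x hx))
  have i3 := abs_le.1 (b3 _ _ u u (hG.taylor y hy x hx))
  have i4 := hG.lower y hy h
  have i5 : ‖fderiv ℝ G y u‖ ≤ K * m :=
    ((fderiv ℝ G y).le_opNorm u).trans (by gcongr; exact hG.norm_fderiv_le y hy)
  have i5 := abs_le.1 (b3 _ _ h h i5)
  have i6 := abs_le.1 (b3 _ _ h k (hG.norm_le y hy))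
  have sy := hG.symm x hx u k
  simp only [_root_.sub_apply, ← hh] at i2 i3
  simp only [map_add, _root_.add_apply, map_smul, _root_.smul_apply,
    smul_eq_mul]
  set U := ‖u‖
  set H := ‖h‖
  set A := ‖k‖
  have hU : 0 ≤ U := norm_nonneg _
  have hH : 0 ≤ H := norm_nonneg _
  have hA : 0 ≤ A := norm_nonneg _
  have j2 : -(K * H * m * A) ≤ G x u k - G y u k := by
    have : K * H * U * A ≤ K * H * m * A := by gcongr
    linarith [i2.1]
  have j3 : -(K * H ^ 2 * m * m) ≤ G x u u - G y u u - fderiv ℝ G y h u u := by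
    have : K * H ^ 2 * U * U ≤ K * H ^ 2 * m * m := by gcongr
    linarith [i3.1]
  have j5 : -(K * m * H * H) ≤ s * fderiv ℝ G y u h h := by
    have : -(s * (K * m * H * H)) ≤ s * fderiv ℝ G y u h h := by nlinarith [i5.1, hs.1]
    have : s * (K * m * H * H) ≤ 1 * (K * m * H * H) := by gcongr; exact hs.2
    linarith
  have j6 : -(K * H * A) ≤ s * G y h k := by
    have : -(s * (K * H * A)) ≤ s * G y h k := by nlinarith [i6.1, hs.1]
    have : s * (K * H * A) ≤ 1 * (K * H * A) := by gcongr; exact hs.2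
    linarith
  have q2 : 0 ≤ q ^ 2 := sq_nonneg q
  have l2 := mul_le_mul_of_nonneg_left j2 hq
  have l3 := mul_le_mul_of_nonneg_left j3 q2
  have l4 := mul_le_mul_of_nonneg_left i4 (mul_nonneg hm q2)
  have l5 := mul_le_mul_of_nonneg_left j5 (mul_nonneg hm q2)
  have l6 := mul_le_mul_of_nonneg_left j6 (mul_nonneg hm hq)
  have fin : 0 ≤ lam * A ^ 2 - 4 * K * m * (q * H) * A
      + (q * H) ^ 2 * (m * lam - 2 * K * m ^ 2) := by
    have : 0 ≤ lam * (lam * A ^ 2 - 4 * K * m * (q * H) * A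
      + (q * H) ^ 2 * (m * lam - 2 * K * m ^ 2)) := by
      have e : lam * (lam * A ^ 2 - 4 * K * m * (q * H) * A
        + (q * H) ^ 2 * (m * lam - 2 * K * m ^ 2))
        = (lam * A - 2 * K * m * (q * H)) ^ 2
          + (q * H) ^ 2 * m * (lam ^ 2 - m * (4 * K ^ 2 + 2 * K * lam)) := by ring
      rw [e]
      have := sub_nonneg.2 hmK
      positivity
    exact nonneg_of_mul_nonneg_right this hlam
  nlinarith

/-- A short geodesic is no longer than any curve in `B` with the same endpoints. Here `n` is the
speed of the competitor `b`. -/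
lemma MetricBounds.geodesic_minimizes (hG : MetricBounds G B lam K) (hB : IsOpen B)
    {c u : ℝ → E} {m : ℝ} (hm : 0 ≤ m)
    (hmK : m * (4 * K ^ 2 + 2 * K * lam) ≤ lam ^ 2)
    (hc : ∀ t ∈ Icc (0 : ℝ) 1, HasDerivWithinAt c (u t) (Icc 0 1) t)
    (hcB : ∀ t ∈ Icc (0 : ℝ) 1, c t ∈ B)
    (hu : IsParallelField G c u u) (hum : ∀ t ∈ Icc (0 : ℝ) 1, ‖u t‖ ≤ m)
    {b b' : ℝ → E} {n : ℝ → ℝ} (hbc : ContinuousOn b (Icc 0 1))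
    (hb : ∀ t ∈ Ioo (0 : ℝ) 1, HasDerivAt b (b' t) t)
    (hbB : ∀ t ∈ Icc (0 : ℝ) 1, b t ∈ B) (hn : Continuous n) (hn0 : ∀ t, 0 ≤ n t)
    (hnb : ∀ t ∈ Ioo (0 : ℝ) 1, n t ^ 2 = G (b t) (b' t) (b' t))
    (h0 : b 0 = c 0) (h1 : b 1 = c 1) :
    G (c 0) (u 0) (u 0) ≤ (∫ t in (0 : ℝ)..1, n t) ^ 2 := by
  set e := G (c 0) (u 0) (u 0) with he
  set N : ℝ → ℝ := fun t ↦ ∫ s in (0 : ℝ)..t, n s with hN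
  have hN' : ∀ t, HasDerivAt N (n t) t := fun t ↦ hn.integral_hasStrictDerivAt 0 t |>.hasDerivAt
  have hNmono : Monotone N := monotone_of_hasDerivAt_nonneg hN' hn0
  have hN0 : N 0 = 0 := by simp [hN]
  have hN1 : 0 ≤ N 1 := hN0 ▸ hNmono zero_le_one
  change e ≤ N 1 ^ 2
  -- The speed of the competitor may vanish; adding `ε` to it keeps the time change increasing.
  suffices key : ∀ ε : ℝ, 0 < ε → e ≤ (N 1 + ε) * N 1 by
    refine le_of_forall_pos_le_add fun δ hδ ↦ ?_
    have := key (δ / (N 1 + 1)) (by positivity)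
    have h2 : δ / (N 1 + 1) * N 1 ≤ δ := by
      rw [div_mul_eq_mul_div, div_le_iff₀ (by positivity)]
      nlinarith
    nlinarith
  intro ε hε
  set Λ := N 1 + ε with hΛ
  have hΛ0 : 0 < Λ := by positivity
  set φ : ℝ → ℝ := fun t ↦ (N t + ε * t) / Λ with hφ
  set q : ℝ → ℝ := fun t ↦ (n t + ε) / Λ with hq
  have hφ' : ∀ t, HasDerivAt φ (q t) t := fun t ↦ by
    simpa using ((hN' t).add ((hasDerivAt_id t).const_mul ε)).div_const Λ
  have hq0 : ∀ t, 0 < q t := fun t ↦ div_pos (by linarith [hn0 t]) hΛ0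
  have hφmono : StrictMono φ := strictMono_of_hasDerivAt_pos hφ' hq0
  have hφ0 : φ 0 = 0 := by simp [hφ, hN0]
  have hφ1 : φ 1 = 1 := by simp [hφ, ← hΛ, hΛ0.ne']
  have hφI : ∀ t ∈ Icc (0 : ℝ) 1, φ t ∈ Icc (0 : ℝ) 1 := fun t ht ↦
    ⟨hφ0 ▸ hφmono.monotone ht.1, hφ1 ▸ hφmono.monotone ht.2⟩
  have hφO : ∀ t ∈ Ioo (0 : ℝ) 1, φ t ∈ Ioo (0 : ℝ) 1 := fun t ht ↦
    ⟨by simpa [hφ0] using hφmono ht.1, by simpa [hφ1] using hφmono ht.2⟩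
  have hφc : ContinuousOn φ (Icc 0 1) := fun t _ ↦ (hφ' t).continuousAt.continuousWithinAt
  have hNc : ContinuousOn N (Icc 0 1) := fun t _ ↦ (hN' t).continuousAt.continuousWithinAt
  have hcc : ContinuousOn (fun t ↦ c (φ t)) (Icc 0 1) :=
    ContinuousOn.comp (fun t ht ↦ (hc t ht).continuousWithinAt) hφc hφI
  have huc : ContinuousOn (fun t ↦ u (φ t)) (Icc 0 1) :=
    ContinuousOn.comp (fun t ht ↦ (hu t ht).choose_spec.1.continuousWithinAt) hφc hφI
  have hGc : ContinuousOn (fun t ↦ G (c (φ t))) (Icc 0 1) := by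
    refine ContinuousOn.comp (t := B) (fun y hy ↦ ?_) hcc fun t ht ↦ hcB _ (hφI t ht)
    exact (hG.differentiableAt y hy).continuousAt.continuousWithinAt
  have hhc : ContinuousOn (fun t ↦ b t - c (φ t)) (Icc 0 1) := hbc.sub hcc
  -- The last bracket is the first variation term, corrected by the weight `-m φ` against the metric
  -- of the displacement; it vanishes at both endpoints.
  set Ψ : ℝ → ℝ := fun t ↦ Λ * N t - e * φ t
    - (2 * G (c (φ t)) (u (φ t)) (b t - c (φ t))
      - m * φ t * G (c (φ t)) (b t - c (φ t)) (b t - c (φ t))) with hΨ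
  have hΨc : ContinuousOn Ψ (Icc 0 1) := by
    refine ((continuousOn_const.mul hNc).sub (continuousOn_const.mul hφc)).sub
      ((continuousOn_const.mul ((hGc.clm_apply huc).clm_apply hhc)).sub
        ((continuousOn_const.mul hφc).mul ((hGc.clm_apply hhc).clm_apply hhc)))
  have hΨ' : ∀ t ∈ Ioo (0 : ℝ) 1, ∃ D, HasDerivAt Ψ D t ∧ 0 ≤ D := by
    intro t ht
    have hs := hφO t ht
    have hsI := hφI t ⟨ht.1.le, ht.2.le⟩
    have htI : t ∈ Icc (0 : ℝ) 1 := ⟨ht.1.le, ht.2.le⟩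
    have hnhds : Icc (0 : ℝ) 1 ∈ nhds (φ t) := Icc_mem_nhds hs.1 hs.2
    obtain ⟨w, hw, ew⟩ := hu (φ t) hsI
    have dc := ((hc _ hsI).hasDerivAt hnhds).scomp t (hφ' t)
    have du := (hw.hasDerivAt hnhds).scomp t (hφ' t)
    have dG := (hG.differentiableAt _ (hcB _ hsI)).hasFDerivAt.comp_hasDerivAt t dc
    have dh := (hb t ht).sub dc
    have dΨ := (((hN' t).const_mul Λ).sub ((hφ' t).const_mul e)).sub
      ((((dG.clm_apply du).clm_apply dh).const_mul 2).sub
        (((hφ' t).const_mul m).mul ((dG.clm_apply dh).clm_apply dh)))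
    refine ⟨_, dΨ, ?_⟩
    have ine := hG.energy_ineq (hbB t htI) (hcB _ hsI) (u := u (φ t))
      (k := b' t - q t • u (φ t)) (hq0 t).le hsI hm hmK (hum _ hsI)
    rw [sub_add_cancel, ← hnb t ht, hu.inner_const hG hB hc hcB hu hsI, ← he] at ine
    have ewh := ew (b t - c (φ t))
    have sy := hG.symm _ (hcB _ hsI) (b' t - q t • u (φ t)) (b t - c (φ t))
    have hnq : n t ^ 2 ≤ q t * (Λ * n t) := by
      have : q t * (Λ * n t) = (n t + ε) * n t := by
        simp only [hq]; field_simp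
      rw [this]; nlinarith [hn0 t]
    simp only [christoffelForm] at ewh
    simp only [_root_.add_apply, Function.comp_apply, map_smul,
      _root_.smul_apply, smul_eq_mul, Pi.sub_apply] at ine ewh sy ⊢
    refine nonneg_of_mul_nonneg_right (a := q t) ?_ (hq0 t)
    have ewh' : G (c (φ t)) w (b t - c (φ t))
      = -((2 * fderiv ℝ G (c (φ t)) (u (φ t)) (u (φ t)) (b t - c (φ t))
        - fderiv ℝ G (c (φ t)) (b t - c (φ t)) (u (φ t)) (u (φ t))) / 2) := by linarith
    rw [ewh', sy]
    linarith
  have hmono : MonotoneOn Ψ (Icc 0 1) := by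
    refine monotoneOn_of_deriv_nonneg (convex_Icc 0 1) hΨc ?_ ?_
    · intro t ht
      rw [interior_Icc] at ht
      obtain ⟨D, hD, -⟩ := hΨ' t ht
      exact hD.differentiableAt.differentiableWithinAt
    · intro t ht
      rw [interior_Icc] at ht
      obtain ⟨D, hD, hD0⟩ := hΨ' t ht
      rwa [hD.deriv]
  have := hmono (left_mem_Icc.2 zero_le_one) (right_mem_Icc.2 zero_le_one) zero_le_one
  simp only [hΨ, hφ0, hφ1, h0, h1, hN0, sub_self, map_zero, mul_zero, mul_one, sub_zero] at this
  linarith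

end Coordinates

/-! ### Existence of geodesics and parallel transport in coordinates -/

section Existence

open Metric

variable {E : Type*} [NormedAddCommGroup E] [NormedSpace ℝ E]

/-- Uniform Taylor estimates near a point where a map is of class `C^2`. -/
lemma exists_ball_taylor {F : Type*} [NormedAddCommGroup F] [NormedSpace ℝ F] {f : E → F} {p : E}
    (hf : ContDiffAt ℝ 2 f p) : ∃ r > 0, ∃ K > 0, ContinuousOn (fderiv ℝ f) (ball p r) ∧
      ∀ y ∈ ball p r, DifferentiableAt ℝ f y ∧ ‖fderiv ℝ f y‖ ≤ K ∧ ∀ x ∈ ball p r,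
        ‖f x - f y‖ ≤ K * ‖x - y‖ ∧ ‖f x - f y - fderiv ℝ f y (x - y)‖ ≤ K * ‖x - y‖ ^ 2 := by
  have hd : ContDiffAt ℝ 1 (fderiv ℝ f) p := hf.fderiv_right (by norm_num)
  obtain ⟨C, t, ht, hC⟩ := hd.exists_lipschitzOnWith
  have hdiff : ∀ᶠ y in nhds p, DifferentiableAt ℝ f y :=
    (hf.eventually (by simp)).mono fun y hy ↦ hy.differentiableAt (by simp)
  have hbd : ∀ᶠ y in nhds p, ‖fderiv ℝ f y‖ < ‖fderiv ℝ f p‖ + 1 :=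
    hd.continuousAt.norm.eventually_lt continuousAt_const (by simp)
  obtain ⟨r, hr, hrs⟩ := Metric.mem_nhds_iff.1 (Filter.inter_mem ht (hdiff.and hbd))
  set K : ℝ := max (‖fderiv ℝ f p‖ + 1) C with hK
  refine ⟨r, hr, K, lt_max_of_lt_left (by positivity),
    hC.continuousOn.mono fun y hy ↦ (hrs hy).1, fun y hy ↦
    ⟨(hrs hy).2.1, (hrs hy).2.2.le.trans (le_max_left _ _), fun x hx ↦ ⟨?_, ?_⟩⟩⟩
  · exact (convex_ball p r).norm_image_sub_le_of_norm_fderiv_le (fun z hz ↦ (hrs hz).2.1)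
      (fun z hz ↦ (hrs hz).2.2.le.trans (le_max_left _ _)) hy hx
  · have hconv : Convex ℝ (ball p r ∩ closedBall y ‖x - y‖) :=
      (convex_ball p r).inter (convex_closedBall _ _)
    have := hconv.norm_image_sub_le_of_norm_fderiv_le' (𝕜 := ℝ) (f := f) (φ := fderiv ℝ f y)
      (C := K * ‖x - y‖) (fun z hz ↦ (hrs hz.1).2.1) (fun z hz ↦ ?_)
      ⟨hy, mem_closedBall_self (norm_nonneg _)⟩ ⟨hx, by simp [dist_eq_norm]⟩
    · linarith
    · have h1 := hC.norm_sub_le (hrs hz.1).1 (hrs hy).1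
      have h2 : ‖z - y‖ ≤ ‖x - y‖ := by simpa [dist_eq_norm] using hz.2
      calc _ ≤ C * ‖z - y‖ := h1
        _ ≤ K * ‖x - y‖ := by gcongr; exact le_max_right _ _

variable {G : E → E →L[ℝ] E →L[ℝ] ℝ} {B : Set E} {lam K : ℝ}

lemma MetricBounds.mono (hG : MetricBounds G B lam K) {B' : Set E} (h : B' ⊆ B) :
    MetricBounds G B' lam K where
  lam_pos := hG.lam_pos
  pos := hG.pos
  symm y hy := hG.symm y (h hy)
  lower y hy := hG.lower y (h hy)
  norm_le y hy := hG.norm_le y (h hy)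
  differentiableAt y hy := hG.differentiableAt y (h hy)
  norm_fderiv_le y hy := hG.norm_fderiv_le y (h hy)
  lipschitz y hy x hx := hG.lipschitz y (h hy) x (h hx)
  taylor y hy x hx := hG.taylor y (h hy) x (h hx)

lemma exists_metricBounds {p : E} (hG : ContDiffAt ℝ 2 G p)
    (hsymm : ∀ y u v, G y u v = G y v u) (hlam : 0 < lam)
    (hlower : ∀ᶠ y in nhds p, ∀ v, lam * ‖v‖ ^ 2 ≤ G y v v) :
    ∃ r > 0, ∃ K > 0, MetricBounds G (ball p r) lam K ∧
      ContinuousOn (fderiv ℝ G) (ball p r) := by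
  obtain ⟨r, hr, K, hK, hcont, h⟩ := exists_ball_taylor hG
  have hbd : ∀ᶠ y in nhds p, ‖G y‖ < ‖G p‖ + 1 :=
    hG.continuousAt.norm.eventually_lt continuousAt_const (by simp)
  obtain ⟨s, hs, hss⟩ := Metric.mem_nhds_iff.1 (hlower.and hbd)
  have hr' : ball p (min r s) ⊆ ball p r := ball_subset_ball (min_le_left _ _)
  have hs' : ball p (min r s) ⊆ ball p s := ball_subset_ball (min_le_right _ _)
  have hKm : K ≤ max K (‖G p‖ + 1) := le_max_left _ _
  refine ⟨min r s, lt_min hr hs, max K (‖G p‖ + 1), lt_max_of_lt_left hK,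
    ⟨hlam, lt_max_of_lt_left hK, fun y _ ↦ hsymm y, fun y hy ↦ (hss (hs' hy)).1,
      fun y hy ↦ (hss (hs' hy)).2.le.trans (le_max_right _ _), fun y hy ↦ (h y (hr' hy)).1,
      fun y hy ↦ (h y (hr' hy)).2.1.trans hKm, fun y hy x hx ↦ ?_, fun y hy x hx ↦ ?_⟩,
    hcont.mono hr'⟩
  · exact ((h y (hr' hy)).2.2 x (hr' hx)).1.trans (by gcongr)
  · exact ((h y (hr' hy)).2.2 x (hr' hx)).2.trans (by gcongr)

/-- The derivative `a = -Γ_y(u, w)` of a parallel field is bounded by a multiple of `‖u‖ ‖w‖`. -/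
lemma MetricBounds.norm_le_of_christoffel (hG : MetricBounds G B lam K) {y : E} (hy : y ∈ B)
    {a u w : E} (h : ∀ z, G y a z + christoffelForm G y u w z = 0) :
    ‖a‖ ≤ 3 * K / (2 * lam) * ‖u‖ * ‖w‖ := by
  have hlam := hG.lam_pos
  have hK := hG.pos
  rcases (norm_nonneg a).eq_or_lt' with ha | ha
  · rw [ha]; positivity
  have b3 : ∀ x₁ x₂ x₃ : E, |fderiv ℝ G y x₁ x₂ x₃| ≤ K * ‖x₁‖ * ‖x₂‖ * ‖x₃‖ := by
    intro x₁ x₂ x₃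
    have h1 := (fderiv ℝ G y x₁).le_opNorm₂ x₂ x₃
    have h2 : ‖fderiv ℝ G y x₁‖ ≤ K * ‖x₁‖ :=
      ((fderiv ℝ G y).le_opNorm x₁).trans (by gcongr; exact hG.norm_fderiv_le y hy)
    rw [Real.norm_eq_abs] at h1
    exact h1.trans (by gcongr)
  have h1 := abs_le.1 (b3 u w a)
  have h2 := abs_le.1 (b3 w u a)
  have h3 := abs_le.1 (b3 a u w)
  have h4 := hG.lower y hy a
  have h5 := h a
  simp only [christoffelForm] at h5
  have h6 : lam * ‖a‖ * ‖a‖ ≤ 3 * K / 2 * ‖u‖ * ‖w‖ * ‖a‖ := by nlinarith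
  have h7 := le_of_mul_le_mul_right h6 ha
  rw [show 3 * K / (2 * lam) * ‖u‖ * ‖w‖ = (3 * K / 2 * ‖u‖ * ‖w‖) / lam by field_simp,
    le_div_iff₀ hlam]
  linarith

/-- The Christoffel form `Γ_y(u, w; ·)` as an operator depending linearly on the derivative `D` of
the metric at `y` and on `u`. -/
def christoffelOp (D : E →L[ℝ] E →L[ℝ] E →L[ℝ] ℝ) (u : E) : E →L[ℝ] E →L[ℝ] ℝ :=
  (1 / 2 : ℝ) • (D u + ContinuousLinearMap.flipₗᵢ ℝ E E (E →L[ℝ] ℝ) D u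
    - ContinuousLinearMap.flipₗᵢ ℝ E E ℝ (ContinuousLinearMap.flipₗᵢ ℝ E E (E →L[ℝ] ℝ) D u))

lemma christoffelOp_apply (y u w z : E) :
    christoffelOp (fderiv ℝ G y) u w z = christoffelForm G y u w z := by
  simp [christoffelOp, christoffelForm]
  ring

/-- The Christoffel operator of the second kind, `w ↦ Γ_y(u, w)`. -/
def christoffelMap (G : E → E →L[ℝ] E →L[ℝ] ℝ) (y u : E) : E →L[ℝ] E :=
  (G y).inverse ∘L christoffelOp (fderiv ℝ G y) u

variable [FiniteDimensional ℝ E]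

lemma MetricBounds.isInvertible (hG : MetricBounds G B lam K) {y : E} (hy : y ∈ B) :
    (G y).IsInvertible := by
  have hinj : Function.Injective (G y : E →ₗ[ℝ] E →L[ℝ] ℝ) := by
    rw [← LinearMap.ker_eq_bot, LinearMap.ker_eq_bot']
    intro v hv
    have h1 := hG.lower y hy v
    have h2 : G y v v = 0 := by
      have : G y v = 0 := hv
      simp [this]
    rw [h2] at h1
    have h3 : ‖v‖ ^ 2 ≤ 0 := nonpos_of_mul_nonpos_right h1 hG.lam_pos
    simpa using h3
  have hdim : Module.finrank ℝ E = Module.finrank ℝ (E →L[ℝ] ℝ) := by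
    rw [← (LinearMap.toContinuousLinearMap (𝕜 := ℝ) (E := E) (F' := ℝ)).finrank_eq]
    exact Subspace.dual_finrank_eq.symm
  let e := (LinearEquiv.ofInjectiveOfFinrankEq (G y : E →ₗ[ℝ] E →L[ℝ] ℝ) hinj hdim)
  refine ⟨e.toContinuousLinearEquiv, ?_⟩
  ext v w
  rfl

lemma MetricBounds.apply_christoffelMap (hG : MetricBounds G B lam K) {y : E} (hy : y ∈ B)
    (u w z : E) : G y (christoffelMap G y u w) z = christoffelForm G y u w z := by
  obtain ⟨e, he⟩ := hG.isInvertible hy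
  rw [christoffelMap, ← he, ContinuousLinearMap.inverse_equiv]
  simp [christoffelOp_apply]

lemma contDiffAt_inverse {n : ℕ∞ω} {p : E} (hG : ContDiffAt ℝ n G p)
    (hinv : (G p).IsInvertible) : ContDiffAt ℝ n (fun y ↦ (G y).inverse) p := by
  have : CompleteSpace E := FiniteDimensional.complete ℝ E
  exact (hinv.contDiffAt_map_inverse).comp p hG

lemma contDiffAt_christoffelMap {p v : E} (hG : ContDiffAt ℝ 2 G p)
    (hinv : (G p).IsInvertible) :
    ContDiffAt ℝ 1 (fun z : E × E ↦ christoffelMap G z.1 z.2) (p, v) := by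
  have hd : ContDiffAt ℝ 1 (fderiv ℝ G) p := hG.fderiv_right (by norm_num)
  have hD : ContDiffAt ℝ 1 (fun z : E × E ↦ fderiv ℝ G z.1) (p, v) :=
    ContDiffAt.comp (p, v) (f := Prod.fst) hd contDiffAt_fst
  have hI : ContDiffAt ℝ 1 (fun z : E × E ↦ (G z.1).inverse) (p, v) :=
    ContDiffAt.comp (p, v) (f := Prod.fst)
      (contDiffAt_inverse (hG.of_le (by norm_num)) hinv) contDiffAt_fst
  have hF : ContDiffAt ℝ 1
      (fun z : E × E ↦ ContinuousLinearMap.flipₗᵢ ℝ E E (E →L[ℝ] ℝ) (fderiv ℝ G z.1) z.2)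
      (p, v) :=
    ((ContinuousLinearMap.flipₗᵢ ℝ E E (E →L[ℝ] ℝ)).contDiff.contDiffAt.comp _ hD).clm_apply
      contDiffAt_snd
  have hFF := (ContinuousLinearMap.flipₗᵢ ℝ E E ℝ).contDiff.contDiffAt.comp _ hF
  exact hI.clm_comp ((((hD.clm_apply contDiffAt_snd).add hF).sub hFF).const_smul (1 / 2 : ℝ))

/-- The solution of an ordinary differential equation given by the Picard-Lindelöf theorem stays in
the ball of the hypothesis. -/
lemma exists_mem_closedBall_hasDerivWithinAt {F : Type*} [NormedAddCommGroup F] [NormedSpace ℝ F]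
    [CompleteSpace F] {f : ℝ → F → F} {tmin tmax : ℝ} {t₀ : Icc tmin tmax} {x₀ x : F}
    {a r L k : NNReal} (hf : IsPicardLindelof f t₀ x₀ a r L k) (hx : x ∈ closedBall x₀ r) :
    ∃ α : ℝ → F, α t₀ = x ∧ ∀ t ∈ Icc tmin tmax, α t ∈ closedBall x₀ a ∧
      HasDerivWithinAt α (f t (α t)) (Icc tmin tmax) t := by
  obtain ⟨α, hα⟩ := ODE.FunSpace.exists_isFixedPt_next hf hx
  have hmem : ∀ t, α.compProj t ∈ closedBall x₀ a := fun t ↦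
    α.compProj_mem_closedBall hf.mul_max_le
  refine ⟨α.compProj, by rw [ODE.FunSpace.compProj_val, ← hα, ODE.FunSpace.next_apply₀],
    fun t ht ↦ ⟨hmem t, ?_⟩⟩
  refine ODE.hasDerivWithinAt_picard_Icc t₀.2 hf.continuousOn_uncurry
    α.continuous_compProj.continuousOn (fun _ _ ↦ hmem _) x ht |>.congr_of_mem ?_ ht
  intro t' ht'
  nth_rw 1 [← hα]
  rw [ODE.FunSpace.compProj_of_mem ht', ODE.FunSpace.next_apply]

/-- Short geodesics exist, uniformly in the initial conditions. -/
lemma exists_geodesic {p₀ : E} {ρ : ℝ} (hρ : 0 < ρ) (hG : MetricBounds G (ball p₀ ρ) lam K)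
    (hG2 : ContDiffAt ℝ 2 G p₀) :
    ∃ δ > 0, ∀ p ∈ ball p₀ δ, ∀ v : E, ‖v‖ < δ → ∃ c u : ℝ → E, c 0 = p ∧ u 0 = v ∧
      (∀ t ∈ Icc (0 : ℝ) 1, c t ∈ ball p₀ ρ) ∧
      (∀ t ∈ Icc (0 : ℝ) 1, HasDerivWithinAt c (u t) (Icc 0 1) t) ∧
      IsParallelField G c u u := by
  have : CompleteSpace E := FiniteDimensional.complete ℝ E
  have hinv := hG.isInvertible (mem_ball_self hρ)
  -- Trajectories of the geodesic vector field from initial data near `(p₀, 0)` exist up to a uniform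
  -- time `ε`; rescaling time by `ε` turns them into geodesics on `[0, 1]` of small velocity.
  set f : E × E → E × E := fun z ↦ (z.2, -christoffelMap G z.1 z.2 z.2) with hf
  have hfC : ContDiffAt ℝ 1 f (p₀, 0) :=
    contDiffAt_snd.prodMk ((contDiffAt_christoffelMap hG2 hinv).clm_apply contDiffAt_snd).neg
  obtain ⟨ε₀, hε₀, a, r, L, k, hr, hPL⟩ := IsPicardLindelof.of_contDiffAt_one hfC
  have ha : 0 < a := by
    have h1 := (hPL 0).mul_max_le
    have h2 : (0 : ℝ) ≤ (L : ℝ) * max (0 + ε₀ - 0) (0 - (0 - ε₀)) := by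
      have : (0 : ℝ) ≤ max (0 + ε₀ - 0) (0 - (0 - ε₀)) := le_max_of_le_left (by linarith)
      positivity
    have h3 : (0 : ℝ) < r := hr
    have : (0 : ℝ) < a := by
      simp only at h1
      linarith
    exact this
  set a' : NNReal := min a (ρ / 2).toNNReal with ha'
  have ha'0 : 0 < a' := lt_min ha (Real.toNNReal_pos.2 (by positivity))
  obtain ⟨ε, hε, hPL'⟩ := IsPicardLindelof.exists_shrink_radius hε₀ (hPL 0)
    (min_le_left a (ρ / 2).toNNReal) (NNReal.half_lt_self ha'0.ne')
  have hr'0 : (0 : ℝ) < ((a' / 2 : NNReal) : ℝ) := by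
    have : 0 < a' / 2 := by positivity
    exact_mod_cast this
  have ha'ρ : (a' : ℝ) < ρ := by
    have h1 : a' ≤ (ρ / 2).toNNReal := min_le_right _ _
    have h2 : (a' : ℝ) ≤ ((ρ / 2).toNNReal : ℝ) := by exact_mod_cast h1
    rw [Real.coe_toNNReal _ (by positivity)] at h2
    linarith
  set r' : ℝ := ((a' / 2 : NNReal) : ℝ) with hr'
  refine ⟨min r' (ε * r'), lt_min hr'0 (by positivity), fun p hp v hv ↦ ?_⟩
  have hmem : ((p, ε⁻¹ • v) : E × E) ∈ closedBall ((p₀, 0) : E × E) r' := by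
    rw [mem_closedBall, Prod.dist_eq, max_le_iff]
    refine ⟨(hp.trans_le (min_le_left _ _)).le, ?_⟩
    rw [dist_zero_right, norm_smul, norm_inv, Real.norm_of_nonneg hε.le, inv_mul_le_iff₀ hε]
    exact (hv.trans_le (min_le_right _ _)).le
  obtain ⟨α, hα0, hα⟩ := exists_mem_closedBall_hasDerivWithinAt hPL' hmem
  simp only at hα0
  have hmaps : MapsTo (fun t : ℝ ↦ ε * t) (Icc 0 1) (Icc (0 - ε) (0 + ε)) := by
    intro t ht
    constructor <;> nlinarith [ht.1, ht.2]
  have hball : ∀ t ∈ Icc (0 : ℝ) 1, (α (ε * t)).1 ∈ ball p₀ ρ := by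
    intro t ht
    have h1 := (hα _ (hmaps ht)).1
    rw [mem_closedBall, Prod.dist_eq, max_le_iff] at h1
    exact h1.1.trans_lt ha'ρ
  have hder : ∀ t ∈ Icc (0 : ℝ) 1,
      HasDerivWithinAt (fun t ↦ α (ε * t)) (ε • f (α (ε * t))) (Icc 0 1) t := by
    intro t ht
    have h1 : HasDerivWithinAt (fun t : ℝ ↦ ε * t) ε (Icc 0 1) t := by
      simpa using ((hasDerivAt_id t).const_mul ε).hasDerivWithinAt
    exact ((hα _ (hmaps ht)).2).scomp t h1 hmaps
  refine ⟨fun t ↦ (α (ε * t)).1, fun t ↦ ε • (α (ε * t)).2, by simp [hα0],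
    by simp [hα0, hε.ne'], hball, fun t ht ↦ ?_, fun t ht ↦ ?_⟩
  · exact (ContinuousLinearMap.fst ℝ E E).hasFDerivAt.comp_hasDerivWithinAt t (hder t ht)
  · refine ⟨_, ((ContinuousLinearMap.snd ℝ E E).hasFDerivAt.comp_hasDerivWithinAt t
      (hder t ht)).const_smul ε, fun z ↦ ?_⟩
    simp only [hf, ContinuousLinearMap.coe_snd', Prod.smul_mk, smul_neg, map_neg, map_smul, _root_.neg_apply,
      _root_.smul_apply, smul_eq_mul, hG.apply_christoffelMap (hball t ht)]
    simp only [christoffelForm, map_smul, _root_.smul_apply, smul_eq_mul]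
    ring

/-- Parallel transport exists along a curve of small velocity. -/
lemma exists_parallelField (hG : MetricBounds G B lam K)
    (hG' : ContinuousOn (fderiv ℝ G) B) {c u : ℝ → E} (hcB : ∀ t ∈ Icc (0 : ℝ) 1, c t ∈ B)
    (hc : ContinuousOn c (Icc 0 1)) (hu : ContinuousOn u (Icc 0 1))
    (hum : ∀ t ∈ Icc (0 : ℝ) 1, 3 * K / (2 * lam) * ‖u t‖ ≤ 1 / 2) (w₀ : E) :
    ∃ w : ℝ → E, w 0 = w₀ ∧ IsParallelField G c u w := by
  have : CompleteSpace E := FiniteDimensional.complete ℝ E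
  set f : ℝ → E → E := fun t w ↦ -christoffelMap G (c t) (u t) w with hf
  have heq : ∀ t ∈ Icc (0 : ℝ) 1, ∀ w z,
      G (c t) (f t w) z + christoffelForm G (c t) (u t) w z = 0 := by
    intro t ht w z
    simp [hf, hG.apply_christoffelMap (hcB t ht)]
  have hbd : ∀ t ∈ Icc (0 : ℝ) 1, ∀ w, ‖f t w‖ ≤ 1 / 2 * ‖w‖ := fun t ht w ↦
    (hG.norm_le_of_christoffel (hcB t ht) (heq t ht w)).trans (by gcongr; exact hum t ht)
  have hcont : ∀ w, ContinuousOn (f · w) (Icc 0 1) := by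
    intro w
    have hD : ContinuousOn (fun t ↦ fderiv ℝ G (c t)) (Icc 0 1) := hG'.comp hc hcB
    have hI : ContinuousOn (fun t ↦ (G (c t)).inverse) (Icc 0 1) := by
      refine ContinuousOn.comp (t := B) (g := fun y ↦ (G y).inverse) (fun y hy ↦ ?_) hc hcB
      exact (((hG.isInvertible hy).contDiffAt_map_inverse (n := 0)).continuousAt.comp
        (hG.differentiableAt y hy).continuousAt).continuousWithinAt
    have hF : ContinuousOn (fun t ↦ ContinuousLinearMap.flipₗᵢ ℝ E E (E →L[ℝ] ℝ)
        (fderiv ℝ G (c t)) (u t)) (Icc 0 1) :=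
      ((ContinuousLinearMap.flipₗᵢ ℝ E E (E →L[ℝ] ℝ)).continuous.comp_continuousOn hD).clm_apply hu
    have hFF := (ContinuousLinearMap.flipₗᵢ ℝ E E ℝ).continuous.comp_continuousOn hF
    exact ((hI.clm_comp ((((hD.clm_apply hu).add hF).sub hFF).const_smul
      (1 / 2 : ℝ))).clm_apply continuousOn_const).neg
  have hPL : IsPicardLindelof f (tmin := 0) (tmax := 1) ⟨0, by simp⟩ w₀ ‖w₀‖₊ 0 ‖w₀‖₊ 1 := by
    refine ⟨fun t ht ↦ ?_, fun w _ ↦ hcont w, fun t ht w hw ↦ ?_, by simp⟩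
    · refine LipschitzOnWith.of_dist_le_mul fun x _ y _ ↦ ?_
      have h1 : f t x - f t y = f t (x - y) := by simp [hf]; abel
      have h2 := hbd t ht (x - y)
      rw [dist_eq_norm, dist_eq_norm, h1, NNReal.coe_one]
      linarith [norm_nonneg (x - y)]
    · have h1 : ‖w‖ ≤ 2 * ‖w₀‖ := by
        have h2 : ‖w - w₀‖ ≤ ‖w₀‖ := by simpa [dist_eq_norm] using hw
        have h3 := norm_add_le (w - w₀) w₀
        rw [sub_add_cancel] at h3
        linarith
      have := hbd t ht w
      rw [coe_nnnorm]
      linarith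
  obtain ⟨w, hw0, hw⟩ := exists_mem_closedBall_hasDerivWithinAt hPL
    (mem_closedBall_self (by simp))
  exact ⟨w, hw0, fun t ht ↦ ⟨_, (hw t ht).2, heq t ht (w t)⟩⟩

end Existence

/-! ### Estimates on coordinate geodesics -/

section Estimates

variable {E : Type*} [NormedAddCommGroup E] [NormedSpace ℝ E]
  {G : E → E →L[ℝ] E →L[ℝ] ℝ} {B : Set E} {lam K : ℝ}

/-- The velocity of a geodesic is bounded by its initial value. -/
lemma MetricBounds.norm_velocity_le (hG : MetricBounds G B lam K) (hB : IsOpen B) {c u : ℝ → E}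
    (hc : ∀ t ∈ Icc (0 : ℝ) 1, HasDerivWithinAt c (u t) (Icc 0 1) t)
    (hcB : ∀ t ∈ Icc (0 : ℝ) 1, c t ∈ B) (hu : IsParallelField G c u u)
    {t : ℝ} (ht : t ∈ Icc (0 : ℝ) 1) : ‖u t‖ ≤ √(K / lam) * ‖u 0‖ := by
  have hlam := hG.lam_pos
  have hK := hG.pos
  have h0 : (0 : ℝ) ∈ Icc (0 : ℝ) 1 := left_mem_Icc.2 zero_le_one
  have h1 := hG.lower _ (hcB t ht) (u t)
  rw [hu.inner_const hG hB hc hcB hu ht] at h1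
  have h2 := (G (c 0)).le_opNorm₂ (u 0) (u 0)
  have h3 : ‖G (c 0)‖ * ‖u 0‖ * ‖u 0‖ ≤ K * ‖u 0‖ * ‖u 0‖ := by
    gcongr; exact hG.norm_le _ (hcB 0 h0)
  have h4 := Real.le_norm_self (G (c 0) (u 0) (u 0))
  refine abs_le_of_sq_le_sq' ?_ (by positivity) |>.2
  rw [mul_pow, Real.sq_sqrt (by positivity), div_mul_eq_mul_div, le_div_iff₀ hlam]
  nlinarith

/-- A geodesic agrees to second order with the straight line of the same initial conditions. -/
lemma MetricBounds.norm_geodesic_sub_le (hG : MetricBounds G B lam K) (hB : IsOpen B)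
    {c u : ℝ → E}
    (hc : ∀ t ∈ Icc (0 : ℝ) 1, HasDerivWithinAt c (u t) (Icc 0 1) t)
    (hcB : ∀ t ∈ Icc (0 : ℝ) 1, c t ∈ B) (hu : IsParallelField G c u u) :
    ‖c 1 - c 0 - u 0‖ ≤ 3 * K / (2 * lam) * (K / lam) * ‖u 0‖ ^ 2 := by
  have hlam := hG.lam_pos
  have hK := hG.pos
  set C := 3 * K / (2 * lam) * (K / lam) * ‖u 0‖ ^ 2 with hC
  have hu' : ∀ t ∈ Icc (0 : ℝ) 1, ∃ a, HasDerivWithinAt u a (Icc 0 1) t ∧ ‖a‖ ≤ C := by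
    intro t ht
    obtain ⟨a, ha, e⟩ := hu t ht
    refine ⟨a, ha, (hG.norm_le_of_christoffel (hcB t ht) e).trans ?_⟩
    have h1 := hG.norm_velocity_le hB hc hcB hu ht
    calc 3 * K / (2 * lam) * ‖u t‖ * ‖u t‖
        ≤ 3 * K / (2 * lam) * (√(K / lam) * ‖u 0‖) * (√(K / lam) * ‖u 0‖) := by gcongr
      _ = 3 * K / (2 * lam) * (√(K / lam) ^ 2) * ‖u 0‖ ^ 2 := by ring
      _ = C := by rw [Real.sq_sqrt (by positivity)]
  choose! a ha haC using hu'
  have h1 : ∀ t ∈ Icc (0 : ℝ) 1, ‖u t - u 0‖ ≤ C := by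
    intro t ht
    have := norm_image_sub_le_of_norm_deriv_le_segment' ha
      (fun x hx ↦ haC x ⟨hx.1, hx.2.le⟩) t ht
    refine this.trans ?_
    have hC0 : 0 ≤ C := by positivity
    nlinarith [ht.2]
  have h2 : ∀ t ∈ Icc (0 : ℝ) 1,
      HasDerivWithinAt (fun t ↦ c t - t • u 0) (u t - u 0) (Icc 0 1) t := fun t ht ↦
    ((hc t ht).sub ((hasDerivAt_id t).smul_const (u 0)).hasDerivWithinAt).congr_deriv (by simp)
  have := norm_image_sub_le_of_norm_deriv_le_segment_01' h2
    (fun x hx ↦ h1 x ⟨hx.1, hx.2.le⟩)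
  convert this using 2
  simp
  abel

/-- The restriction of a geodesic to `[0, s]`, reparametrized by `[0, 1]`. -/
lemma IsParallelField.comp_mul {c u : ℝ → E} (hu : IsParallelField G c u u) {s : ℝ}
    (hs : s ∈ Icc (0 : ℝ) 1) :
    IsParallelField G (fun t ↦ c (s * t)) (fun t ↦ s • u (s * t)) (fun t ↦ s • u (s * t)) := by
  intro t ht
  have hmaps : MapsTo (fun t : ℝ ↦ s * t) (Icc 0 1) (Icc 0 1) := fun t ht ↦
    ⟨mul_nonneg hs.1 ht.1, mul_le_one₀ hs.2 ht.1 ht.2⟩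
  obtain ⟨a, ha, e⟩ := hu _ (hmaps ht)
  have h1 : HasDerivWithinAt (fun t : ℝ ↦ s * t) s (Icc 0 1) t := by
    simpa using ((hasDerivAt_id t).const_mul s).hasDerivWithinAt
  refine ⟨_, (ha.scomp t h1 hmaps).const_smul s, fun z ↦ ?_⟩
  have := e z
  simp only [christoffelForm, map_smul, _root_.smul_apply, smul_eq_mul] at this ⊢
  linear_combination s ^ 2 * this

end Estimates

/-! ### The Riemannian metric in a chart -/

section ChartMetric

variable {E : Type*} [NormedAddCommGroup E] [NormedSpace ℝ E]
  {M : Type*} [TopologicalSpace M] [ChartedSpace E M]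

/-- The tangent vector at the point of coordinates `y` whose coordinate vector, in the chart at
`x₀`, is `w`. -/
def chartVector (x₀ : M) (y w : E) : TangentSpace 𝓘(ℝ, E) ((extChartAt 𝓘(ℝ, E) x₀).symm y) :=
  mfderiv 𝓘(ℝ, E) 𝓘(ℝ, E) (extChartAt 𝓘(ℝ, E) x₀).symm y w

lemma chartVector_smul (x₀ : M) (y w : E) (a : ℝ) :
    chartVector x₀ y (a • w) = a • chartVector x₀ y w :=
  map_smul (mfderiv 𝓘(ℝ, E) 𝓘(ℝ, E) (extChartAt 𝓘(ℝ, E) x₀).symm y) a w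

lemma chartVector_add (x₀ : M) (y w w' : E) :
    chartVector x₀ y (w + w') = chartVector x₀ y w + chartVector x₀ y w' :=
  map_add (mfderiv 𝓘(ℝ, E) 𝓘(ℝ, E) (extChartAt 𝓘(ℝ, E) x₀).symm y) w w'

section

variable [IsManifold 𝓘(ℝ, E) 1 M]

lemma mfderiv_extChartAt_chartVector {x₀ : M} {y : E}
    (hy : y ∈ (extChartAt 𝓘(ℝ, E) x₀).target) (w : E) :
    mfderiv 𝓘(ℝ, E) 𝓘(ℝ, E) (extChartAt 𝓘(ℝ, E) x₀) ((extChartAt 𝓘(ℝ, E) x₀).symm y)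
      (chartVector x₀ y w) = w := by
  have h := mfderiv_extChartAt_comp_mfderivWithin_extChartAt_symm (I := 𝓘(ℝ, E)) hy
  rw [ModelWithCorners.range_eq_univ, mfderivWithin_univ] at h
  exact congrArg (fun T : E →L[ℝ] E ↦ T w) h

lemma chartVector_mfderiv_extChartAt {x₀ : M} {y : E}
    (hy : y ∈ (extChartAt 𝓘(ℝ, E) x₀).target)
    (v : TangentSpace 𝓘(ℝ, E) ((extChartAt 𝓘(ℝ, E) x₀).symm y)) :
    chartVector x₀ y (mfderiv 𝓘(ℝ, E) 𝓘(ℝ, E) (extChartAt 𝓘(ℝ, E) x₀)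
      ((extChartAt 𝓘(ℝ, E) x₀).symm y) v) = v := by
  have h := mfderivWithin_extChartAt_symm_comp_mfderiv_extChartAt (I := 𝓘(ℝ, E)) hy
  rw [ModelWithCorners.range_eq_univ, mfderivWithin_univ] at h
  exact congrArg (fun T : E →L[ℝ] E ↦ T v) h

lemma mdifferentiableAt_extChartAt_symm' {x₀ : M} {y : E}
    (hy : y ∈ (extChartAt 𝓘(ℝ, E) x₀).target) :
    MDifferentiableAt 𝓘(ℝ, E) 𝓘(ℝ, E) (extChartAt 𝓘(ℝ, E) x₀).symm y := by
  have h := mdifferentiableWithinAt_extChartAt_symm (I := 𝓘(ℝ, E)) hy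
  rwa [ModelWithCorners.range_eq_univ, mdifferentiableWithinAt_univ] at h

end

section

variable [IsManifold 𝓘(ℝ, E) ∞ M]

/-- The parametrization of the tangent bundle over a chart is smooth. -/
lemma contMDiffOn_chartVector_prod (x₀ : M) :
    ContMDiffOn 𝓘(ℝ, E × E) 𝓘(ℝ, E).tangent ∞
      (fun z : E × E ↦ (⟨(extChartAt 𝓘(ℝ, E) x₀).symm z.1, chartVector x₀ z.1 z.2⟩ :
        TangentBundle 𝓘(ℝ, E) M)) (Prod.fst ⁻¹' (extChartAt 𝓘(ℝ, E) x₀).target) := by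
  have : IsManifold 𝓘(ℝ, E) 1 M := IsManifold.of_le (n := ∞) (by norm_num)
  have hmaps : ∀ y ∈ (extChartAt 𝓘(ℝ, E) x₀).target,
      (extChartAt 𝓘(ℝ, E) x₀).symm y ∈ (chartAt E x₀).source := fun y hy ↦ by
    simpa using (extChartAt 𝓘(ℝ, E) x₀).map_target hy
  refine ((trivializationAt E (TangentSpace 𝓘(ℝ, E)) x₀).contMDiffOn_iff ?_).2
    ⟨(contMDiffOn_extChartAt_symm x₀).comp contDiff_fst.contMDiff.contMDiffOn fun z hz ↦ hz, ?_⟩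
  · intro z hz
    rw [Trivialization.mem_source]
    exact hmaps z.1 hz
  · refine contDiff_snd.contMDiff.contMDiffOn.congr fun z hz ↦ ?_
    have h1 := mfderiv_extChartAt_chartVector hz z.2
    rw [← TangentBundle.continuousLinearMapAt_trivializationAt (hmaps z.1 hz)] at h1
    rw [← Trivialization.continuousLinearMapAt_apply_of_mem (R := ℝ)]
    · exact h1
    · exact hmaps z.1 hz

lemma contMDiffOn_chartVector (x₀ : M) (w : E) :
    ContMDiffOn 𝓘(ℝ, E) 𝓘(ℝ, E).tangent ∞
      (fun y : E ↦ (⟨(extChartAt 𝓘(ℝ, E) x₀).symm y, chartVector x₀ y w⟩ :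
        TangentBundle 𝓘(ℝ, E) M)) (extChartAt 𝓘(ℝ, E) x₀).target :=
  (contMDiffOn_chartVector_prod x₀).comp
    (contDiff_id.prodMk (contDiff_const (c := w))).contMDiff.contMDiffOn fun _ hy ↦ hy

end

variable [RiemannianBundle (fun x : M ↦ TangentSpace 𝓘(ℝ, E) x)]

lemma coordMetric_eq_inner (x₀ : M) (y u v : E) :
    coordMetric x₀ y u v = inner ℝ (chartVector x₀ y u) (chartVector x₀ y v) := rfl

variable [FiniteDimensional ℝ E]

/-- The metric in the chart at `x₀`, as a field of continuous bilinear forms. -/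
def chartMetric (x₀ : M) (y : E) : E →L[ℝ] E →L[ℝ] ℝ :=
  (LinearMap.mk₂ ℝ (coordMetric x₀ y)
    (fun u u' v ↦ by simp only [coordMetric_eq_inner, chartVector_add, inner_add_left])
    (fun a u v ↦ by
      simp only [coordMetric_eq_inner, chartVector_smul, real_inner_smul_left, smul_eq_mul])
    (fun u v v' ↦ by simp only [coordMetric_eq_inner, chartVector_add, inner_add_right])
    (fun a u v ↦ by
      simp only [coordMetric_eq_inner, chartVector_smul, real_inner_smul_right,
        smul_eq_mul])).toContinuousBilinearMap

lemma chartMetric_apply (x₀ : M) (y u v : E) : chartMetric x₀ y u v = coordMetric x₀ y u v := rfl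

lemma chartMetric_symm (x₀ : M) (y u v : E) : chartMetric x₀ y u v = chartMetric x₀ y v u := by
  simp only [chartMetric_apply, coordMetric_eq_inner, real_inner_comm]

lemma chartMetric_self (x₀ : M) (y u : E) : chartMetric x₀ y u u = ‖chartVector x₀ y u‖ ^ 2 := by
  rw [chartMetric_apply, coordMetric_eq_inner, real_inner_self_eq_norm_sq]

lemma christoffel_eq_christoffelForm {x₀ : M} {y : E}
    (hd : DifferentiableAt ℝ (chartMetric x₀) y) (u v z : E) :
    christoffel x₀ y u v z = christoffelForm (chartMetric x₀) y u v z := by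
  have key : ∀ a b w : E, fderiv ℝ (fun p : E ↦ coordMetric x₀ p a b) y w
      = fderiv ℝ (chartMetric x₀) y w a b := fun a b w ↦ by
    have := ((((ContinuousLinearMap.apply ℝ ℝ b).comp
      (ContinuousLinearMap.apply ℝ (E →L[ℝ] ℝ) a)).hasFDerivAt).comp y hd.hasFDerivAt).fderiv
    exact congrArg (fun T : E →L[ℝ] ℝ ↦ T w) this
  simp only [christoffel, christoffelForm, key]

variable [IsManifold 𝓘(ℝ, E) ∞ M]
  [IsContMDiffRiemannianBundle 𝓘(ℝ, E) ∞ E (fun x : M ↦ TangentSpace 𝓘(ℝ, E) x)]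

lemma contDiffOn_chartMetric (x₀ : M) :
    ContDiffOn ℝ ∞ (chartMetric x₀) (extChartAt 𝓘(ℝ, E) x₀).target := by
  refine contDiffOn_clm_apply.2 fun u ↦ contDiffOn_clm_apply.2 fun v ↦ ?_
  have h : ContMDiffOn 𝓘(ℝ, E) 𝓘(ℝ, ℝ) ∞
      (fun y ↦ inner ℝ (chartVector x₀ y u) (chartVector x₀ y v))
      (extChartAt 𝓘(ℝ, E) x₀).target :=
    ContMDiffOn.inner_bundle (F := E) (IB := 𝓘(ℝ, E)) (contMDiffOn_chartVector x₀ u)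
      (contMDiffOn_chartVector x₀ v)
  exact h.contDiffOn

lemma eventually_le_chartMetric (x₀ : M) : ∃ lam > 0, ∀ᶠ y in nhds (extChartAt 𝓘(ℝ, E) x₀ x₀),
    ∀ v, lam * ‖v‖ ^ 2 ≤ chartMetric x₀ y v v := by
  have : IsManifold 𝓘(ℝ, E) 1 M := IsManifold.of_le (n := ∞) (by norm_num)
  have : IsContinuousRiemannianBundle E (fun x : M ↦ TangentSpace 𝓘(ℝ, E) x) := by
    obtain ⟨g, hg, hg'⟩ := IsContMDiffRiemannianBundle.exists_contMDiff (IB := 𝓘(ℝ, E)) (n := ∞)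
      (F := E) (E := fun x : M ↦ TangentSpace 𝓘(ℝ, E) x)
    exact ⟨g, hg.continuous, hg'⟩
  obtain ⟨C, hC, h⟩ := eventually_norm_trivializationAt_lt E
    (fun x : M ↦ TangentSpace 𝓘(ℝ, E) x) x₀
  refine ⟨(C ^ 2)⁻¹, by positivity, ?_⟩
  have h2 := (continuousAt_extChartAt_symm (I := 𝓘(ℝ, E)) x₀).tendsto
  rw [extChartAt_to_inv] at h2
  filter_upwards [h2.eventually h, (isOpen_extChartAt_target (I := 𝓘(ℝ, E)) x₀).mem_nhds
    (mem_extChartAt_target x₀)] with y hy hyt v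
  have h3 := ContinuousLinearMap.le_opNorm _ (chartVector x₀ y v) |>.trans
    (mul_le_mul_of_nonneg_right hy.le (norm_nonneg _))
  have hs : (extChartAt 𝓘(ℝ, E) x₀).symm y ∈ (chartAt E x₀).source := by
    simpa using (extChartAt 𝓘(ℝ, E) x₀).map_target hyt
  have h4 := mfderiv_extChartAt_chartVector hyt v
  rw [← TangentBundle.continuousLinearMapAt_trivializationAt hs] at h4
  have h5 : ‖v‖ ≤ C * ‖chartVector x₀ y v‖ := by
    refine le_trans (le_of_eq ?_) h3
    exact congrArg norm h4.symm
  rw [chartMetric_self, inv_mul_le_iff₀ (by positivity), ← mul_pow]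
  gcongr

end ChartMetric

lemma contDiffOn_of_isParallelField {E : Type*} [NormedAddCommGroup E] [NormedSpace ℝ E]
    {G : E → E →L[ℝ] E →L[ℝ] ℝ} {c u : ℝ → E}
    (hc : ∀ t ∈ Icc (0 : ℝ) 1, HasDerivWithinAt c (u t) (Icc 0 1) t)
    (hu : IsParallelField G c u u) : ContDiffOn ℝ 1 c (Icc 0 1) := by
  have hU : UniqueDiffOn ℝ (Icc (0 : ℝ) 1) := uniqueDiffOn_Icc zero_lt_one
  refine (contDiffOn_one_iff_derivWithin hU).2 ⟨fun t ht ↦ (hc t ht).differentiableWithinAt, ?_⟩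
  refine ContinuousOn.congr (f := u) (fun t ht ↦ (hu t ht).choose_spec.1.continuousWithinAt)
    fun t ht ↦ (hc t ht).derivWithin (hU t ht)

/-! ### Curves on the manifold given in a chart -/

section ChartCurves

open MeasureTheory

variable {E : Type*} [NormedAddCommGroup E] [NormedSpace ℝ E]
  {M : Type*} [TopologicalSpace M] [ChartedSpace E M] [IsManifold 𝓘(ℝ, E) 1 M]

lemma velocity_symm_comp {x₀ : M} {b : ℝ → E} {b' : E} {t : ℝ} (ht : t ∈ Icc (0 : ℝ) 1)
    (hb : HasDerivWithinAt b b' (Icc 0 1) t) (hbt : b t ∈ (extChartAt 𝓘(ℝ, E) x₀).target) :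
    velocity (E := E) (fun s ↦ (extChartAt 𝓘(ℝ, E) x₀).symm (b s)) t
      = chartVector x₀ (b t) b' := by
  have h := ((mdifferentiableAt_extChartAt_symm' hbt).hasMFDerivAt.comp_hasMFDerivWithinAt t
    hb.hasFDerivWithinAt.hasMFDerivWithinAt).mfderivWithin
    (uniqueMDiffWithinAt_iff_uniqueDiffWithinAt.2 (uniqueDiffOn_Icc zero_lt_one t ht))
  have h2 := congrArg (fun T : ℝ →L[ℝ] E ↦ T 1) h
  refine h2.trans ?_
  change chartVector x₀ (b t) ((1 : ℝ) • b') = _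
  rw [one_smul]

lemma mfderiv_symm_comp_apply {x₀ : M} {b : ℝ → E} {b' : E} {t : ℝ}
    (hb : HasDerivAt b b' t) (hbt : b t ∈ (extChartAt 𝓘(ℝ, E) x₀).target) :
    mfderiv 𝓘(ℝ, ℝ) 𝓘(ℝ, E) (fun s ↦ (extChartAt 𝓘(ℝ, E) x₀).symm (b s)) t (1 : ℝ)
      = chartVector x₀ (b t) b' := by
  have h := ((mdifferentiableAt_extChartAt_symm' hbt).hasMFDerivAt.comp t
    hb.hasFDerivAt.hasMFDerivAt).mfderiv
  have h2 := congrArg (fun T : ℝ →L[ℝ] E ↦ T 1) h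
  refine h2.trans ?_
  change chartVector x₀ (b t) ((1 : ℝ) • b') = _
  rw [one_smul]

variable [FiniteDimensional ℝ E] [RiemannianBundle (fun x : M ↦ TangentSpace 𝓘(ℝ, E) x)]

/-- The length of a curve given in a chart is the integral of its speed `n`. -/
lemma pathELength_symm_comp {x₀ : M} {b b' : ℝ → E} {n : ℝ → ℝ}
    (hb : ∀ t ∈ Ioo (0 : ℝ) 1, HasDerivAt b (b' t) t)
    (hbt : ∀ t ∈ Ioo (0 : ℝ) 1, b t ∈ (extChartAt 𝓘(ℝ, E) x₀).target)
    (hn : Continuous n) (hn0 : ∀ t, 0 ≤ n t)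
    (hnb : ∀ t ∈ Ioo (0 : ℝ) 1, n t ^ 2 = chartMetric x₀ (b t) (b' t) (b' t)) :
    Manifold.pathELength 𝓘(ℝ, E) (fun s ↦ (extChartAt 𝓘(ℝ, E) x₀).symm (b s)) 0 1
      = ENNReal.ofReal (∫ t in (0 : ℝ)..1, n t) := by
  rw [Manifold.pathELength_eq_lintegral_mfderiv_Ioo, intervalIntegral.integral_of_le zero_le_one,
    ofReal_integral_eq_lintegral_ofReal (hn.integrableOn_Ioc) (Filter.Eventually.of_forall hn0),
    restrict_Ioo_eq_restrict_Ioc]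
  rw [← restrict_Ioo_eq_restrict_Ioc]
  refine setLIntegral_congr_fun measurableSet_Ioo fun t ht ↦ ?_
  have h1 := hnb t ht
  rw [chartMetric_self, sq_eq_sq₀ (hn0 t) (norm_nonneg _)] at h1
  rw [h1]
  exact (congrArg enorm (mfderiv_symm_comp_apply (hb t ht) (hbt t ht))).trans (ofReal_norm _).symm

variable {lam K : ℝ} {B : Set E}

lemma isParallelAlong_symm_comp {x₀ : M} (hBt : B ⊆ (extChartAt 𝓘(ℝ, E) x₀).target)
    (hG : MetricBounds (chartMetric x₀) B lam K) {c u w : ℝ → E}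
    (hcB : ∀ t ∈ Icc (0 : ℝ) 1, c t ∈ B)
    (hc : ∀ t ∈ Icc (0 : ℝ) 1, HasDerivWithinAt c (u t) (Icc 0 1) t)
    (hw : IsParallelField (chartMetric x₀) c u w)
    {V : ∀ t : ℝ, TangentSpace 𝓘(ℝ, E) ((extChartAt 𝓘(ℝ, E) x₀).symm (c t))}
    (hV : ∀ t ∈ Icc (0 : ℝ) 1, V t = chartVector x₀ (c t) (w t)) :
    IsParallelAlong (fun t ↦ (extChartAt 𝓘(ℝ, E) x₀).symm (c t)) V := by
  intro t ht
  have hct := hBt (hcB t ht)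
  have hφ : ∀ s ∈ Icc (0 : ℝ) 1,
      extChartAt 𝓘(ℝ, E) x₀ ((extChartAt 𝓘(ℝ, E) x₀).symm (c s)) = c s := fun s hs ↦
    (extChartAt 𝓘(ℝ, E) x₀).right_inv (hBt (hcB s hs))
  have hf : ∀ s ∈ Icc (0 : ℝ) 1,
      coordField x₀ (fun t ↦ (extChartAt 𝓘(ℝ, E) x₀).symm (c t)) V s = w s := fun s hs ↦ by
    rw [coordField, hV s hs]
    exact mfderiv_extChartAt_chartVector (hBt (hcB s hs)) (w s)
  obtain ⟨w', hw', e⟩ := hw t ht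
  refine ⟨x₀, (extChartAt 𝓘(ℝ, E) x₀).map_target hct, u t, w',
    (hc t ht).congr_of_mem (fun s hs ↦ hφ s hs) ht, hw'.congr_of_mem (fun s hs ↦ hf s hs) ht,
    fun z ↦ ?_⟩
  rw [hφ t ht, hf t ht, christoffel_eq_christoffelForm (hG.differentiableAt _ (hcB t ht))]
  exact e z

lemma isGeodesic_symm_comp {x₀ : M} (hBt : B ⊆ (extChartAt 𝓘(ℝ, E) x₀).target)
    (hG : MetricBounds (chartMetric x₀) B lam K) {c u : ℝ → E}
    (hcB : ∀ t ∈ Icc (0 : ℝ) 1, c t ∈ B)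
    (hc : ∀ t ∈ Icc (0 : ℝ) 1, HasDerivWithinAt c (u t) (Icc 0 1) t)
    (hu : IsParallelField (chartMetric x₀) c u u) :
    IsGeodesic (E := E) (fun t ↦ (extChartAt 𝓘(ℝ, E) x₀).symm (c t)) :=
  ⟨(contMDiffOn_extChartAt_symm x₀).comp (contDiffOn_of_isParallelField hc hu).contMDiffOn
      fun t ht ↦ hBt (hcB t ht),
    isParallelAlong_symm_comp hBt hG hcB hc hu
      fun t ht ↦ velocity_symm_comp ht (hc t ht) (hBt (hcB t ht))⟩

end ChartCurves

/-! ### Short geodesics are minimizing -/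

section Minimizing

variable {E : Type*} [NormedAddCommGroup E] [NormedSpace ℝ E] [FiniteDimensional ℝ E]
  {M : Type*} [EMetricSpace M] [ChartedSpace E M] [IsManifold 𝓘(ℝ, E) 1 M]
  [RiemannianBundle (fun x : M ↦ TangentSpace 𝓘(ℝ, E) x)] [IsRiemannianManifold 𝓘(ℝ, E) M]
  {lam K : ℝ} {B : Set E}

/-- Short geodesics are minimizing: a shorter curve could not leave the domain of the chart, where
the comparison takes place. -/
lemma isMinimizingGeodesic_symm_comp {x₀ : M} (hB : IsOpen B)
    (hBt : B ⊆ (extChartAt 𝓘(ℝ, E) x₀).target)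
    (hG : MetricBounds (chartMetric x₀) B lam K) {ρ : ENNReal} (hρ' : ρ ≠ ⊤)
    (hρ : ∀ q : M, edist x₀ q < ρ → q ∈ (extChartAt 𝓘(ℝ, E) x₀).source ∧
      extChartAt 𝓘(ℝ, E) x₀ q ∈ B)
    {c u : ℝ → E} (hcB : ∀ t ∈ Icc (0 : ℝ) 1, c t ∈ B)
    (hc : ∀ t ∈ Icc (0 : ℝ) 1, HasDerivWithinAt c (u t) (Icc 0 1) t)
    (hu : IsParallelField (chartMetric x₀) c u u) {m : ℝ} (hm : 0 ≤ m)
    (hmK : m * (4 * K ^ 2 + 2 * K * lam) ≤ lam ^ 2)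
    (hum : ∀ t ∈ Icc (0 : ℝ) 1, ‖u t‖ ≤ m)
    (hlen : edist x₀ ((extChartAt 𝓘(ℝ, E) x₀).symm (c 0))
      + ENNReal.ofReal ‖chartVector x₀ (c 0) (u 0)‖ ≤ ρ) :
    IsMinimizingGeodesic (E := E) (fun t ↦ (extChartAt 𝓘(ℝ, E) x₀).symm (c t)) ∧
      edist ((extChartAt 𝓘(ℝ, E) x₀).symm (c 0)) ((extChartAt 𝓘(ℝ, E) x₀).symm (c 1))
        = ENNReal.ofReal ‖chartVector x₀ (c 0) (u 0)‖ := by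
  set ℓ := ‖chartVector x₀ (c 0) (u 0)‖ with hℓ
  have hIoo : ∀ t ∈ Ioo (0 : ℝ) 1, t ∈ Icc (0 : ℝ) 1 := fun t ht ↦ ⟨ht.1.le, ht.2.le⟩
  have h0 : (0 : ℝ) ∈ Icc (0 : ℝ) 1 := left_mem_Icc.2 zero_le_one
  have hgeo := isGeodesic_symm_comp hBt hG hcB hc hu
  have hL : Manifold.pathELength 𝓘(ℝ, E) (fun t ↦ (extChartAt 𝓘(ℝ, E) x₀).symm (c t)) 0 1
      = ENNReal.ofReal ℓ := by
    rw [pathELength_symm_comp (b' := u) (n := fun _ ↦ ℓ)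
      (fun t ht ↦ (hc t (hIoo t ht)).hasDerivAt (Icc_mem_nhds ht.1 ht.2))
      (fun t ht ↦ hBt (hcB t (hIoo t ht))) continuous_const (fun _ ↦ norm_nonneg _)
      (fun t ht ↦ ?_)]
    · simp
    · rw [hu.inner_const hG hB hc hcB hu (hIoo t ht), chartMetric_self]
  have hle : edist ((extChartAt 𝓘(ℝ, E) x₀).symm (c 0)) ((extChartAt 𝓘(ℝ, E) x₀).symm (c 1))
      ≤ ENNReal.ofReal ℓ := by
    rw [IsRiemannianManifold.out (I := 𝓘(ℝ, E)), ← hL]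
    exact Manifold.riemannianEDist_le_pathELength hgeo.1 rfl rfl zero_le_one
  have hge : ENNReal.ofReal ℓ ≤
      edist ((extChartAt 𝓘(ℝ, E) x₀).symm (c 0)) ((extChartAt 𝓘(ℝ, E) x₀).symm (c 1)) := by
    by_contra! hlt
    rw [IsRiemannianManifold.out (I := 𝓘(ℝ, E))] at hlt
    obtain ⟨β, hβ0, hβ1, hβ, hβlen⟩ := Manifold.exists_lt_of_riemannianEDist_lt hlt
    have hβρ : ∀ t ∈ Icc (0 : ℝ) 1, edist x₀ (β t) < ρ := by
      intro t ht
      have h1 : edist ((extChartAt 𝓘(ℝ, E) x₀).symm (c 0)) (β t) < ENNReal.ofReal ℓ := by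
        rw [IsRiemannianManifold.out (I := 𝓘(ℝ, E))]
        refine (Manifold.riemannianEDist_le_pathELength (hβ.mono (Icc_subset_Icc_right ht.2))
          hβ0 rfl ht.1).trans_lt ((Manifold.pathELength_mono le_rfl ht.2).trans_lt hβlen)
      have h2 : edist x₀ ((extChartAt 𝓘(ℝ, E) x₀).symm (c 0)) ≠ ⊤ :=
        ne_top_of_le_ne_top hρ' (le_self_add.trans hlen)
      refine (edist_triangle _ ((extChartAt 𝓘(ℝ, E) x₀).symm (c 0)) _).trans_lt (lt_of_lt_of_le ?_ hlen)
      exact ENNReal.add_lt_add_left h2 h1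
    set b : ℝ → E := fun t ↦ extChartAt 𝓘(ℝ, E) x₀ (β t) with hb
    have hbB : ∀ t ∈ Icc (0 : ℝ) 1, b t ∈ B := fun t ht ↦ (hρ _ (hβρ t ht)).2
    have hbβ : ∀ t ∈ Icc (0 : ℝ) 1, (extChartAt 𝓘(ℝ, E) x₀).symm (b t) = β t := fun t ht ↦
      (extChartAt 𝓘(ℝ, E) x₀).left_inv (hρ _ (hβρ t ht)).1
    have hbC : ContDiffOn ℝ 1 b (Icc 0 1) := by
      have h1 : ContMDiffOn 𝓘(ℝ, ℝ) 𝓘(ℝ, E) 1 b (Icc 0 1) :=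
        (contMDiffOn_extChartAt (I := 𝓘(ℝ, E)) (x := x₀)).comp hβ fun t ht ↦ by
          simpa using (hρ _ (hβρ t ht)).1
      exact h1.contDiffOn
    have hU : UniqueDiffOn ℝ (Icc (0 : ℝ) 1) := uniqueDiffOn_Icc zero_lt_one
    set b' : ℝ → E := derivWithin b (Icc 0 1) with hb'
    have hb'C : ContinuousOn b' (Icc 0 1) := ((contDiffOn_one_iff_derivWithin hU).1 hbC).2
    have hbd : ∀ t ∈ Ioo (0 : ℝ) 1, HasDerivAt b (b' t) t := fun t ht ↦
      ((hbC.differentiableOn one_ne_zero t (hIoo t ht)).hasDerivWithinAt).hasDerivAt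
        (Icc_mem_nhds ht.1 ht.2)
    have hGb : ContinuousOn (fun t ↦ √(chartMetric x₀ (b t) (b' t) (b' t))) (Icc 0 1) := by
      have h1 : ContinuousOn (fun t ↦ chartMetric x₀ (b t)) (Icc 0 1) :=
        ContinuousOn.comp (t := B) (g := chartMetric x₀) (fun y hy ↦
          (hG.differentiableAt y hy).continuousAt.continuousWithinAt) hbC.continuousOn hbB
      exact Real.continuous_sqrt.comp_continuousOn ((h1.clm_apply hb'C).clm_apply hb'C)
    set n : ℝ → ℝ := IccExtend (zero_le_one (α := ℝ))
      ((Icc (0 : ℝ) 1).domRestrict fun t ↦ √(chartMetric x₀ (b t) (b' t) (b' t))) with hn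
    have hnC : Continuous n := hGb.domRestrict.Icc_extend'
    have hn0 : ∀ t, 0 ≤ n t := fun t ↦ Real.sqrt_nonneg _
    have hnb : ∀ t ∈ Ioo (0 : ℝ) 1, n t ^ 2 = chartMetric x₀ (b t) (b' t) (b' t) := by
      intro t ht
      rw [hn, IccExtend_of_mem _ _ (hIoo t ht), domRestrict_apply, Real.sq_sqrt]
      rw [chartMetric_self]
      positivity
    have hlenβ := pathELength_symm_comp hbd (fun t ht ↦ hBt (hbB t (hIoo t ht))) hnC hn0 hnb
    rw [Manifold.pathELength_congr hbβ] at hlenβ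
    have h1 : (1 : ℝ) ∈ Icc (0 : ℝ) 1 := right_mem_Icc.2 zero_le_one
    have hmin := hG.geodesic_minimizes hB hm hmK hc hcB hu hum hbC.continuousOn hbd hbB hnC hn0
      hnb (by rw [hb]; simp only [hβ0]; exact (extChartAt 𝓘(ℝ, E) x₀).right_inv (hBt (hcB 0 h0)))
      (by rw [hb]; simp only [hβ1]; exact (extChartAt 𝓘(ℝ, E) x₀).right_inv (hBt (hcB 1 h1)))
    rw [chartMetric_self] at hmin
    have h3 : ℓ ≤ ∫ t in (0 : ℝ)..1, n t :=
      (sq_le_sq₀ (norm_nonneg _) (intervalIntegral.integral_nonneg zero_le_one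
        fun t _ ↦ hn0 t)).1 hmin
    rw [hlenβ] at hβlen
    exact absurd (ENNReal.ofReal_le_ofReal h3) (not_le.2 hβlen)
  exact ⟨⟨hgeo, hL.trans (le_antisymm hge hle)⟩, le_antisymm hle hge⟩

end Minimizing

/-! ### Functions and gradients in a chart -/

section ChartFunction

variable {E : Type*} [NormedAddCommGroup E] [NormedSpace ℝ E]
  {M : Type*} [TopologicalSpace M] [ChartedSpace E M] [IsManifold 𝓘(ℝ, E) 1 M]

lemma contDiffOn_comp_symm {f : M → ℝ} (hf : ContMDiff 𝓘(ℝ, E) 𝓘(ℝ, ℝ) 1 f) (x₀ : M) :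
    ContDiffOn ℝ 1 (fun y ↦ f ((extChartAt 𝓘(ℝ, E) x₀).symm y))
      (extChartAt 𝓘(ℝ, E) x₀).target :=
  (hf.comp_contMDiffOn (contMDiffOn_extChartAt_symm x₀)).contDiffOn

lemma hasFDerivAt_comp_symm {f : M → ℝ} (hf : ContMDiff 𝓘(ℝ, E) 𝓘(ℝ, ℝ) 1 f) {x₀ : M} {y : E}
    (hy : y ∈ (extChartAt 𝓘(ℝ, E) x₀).target) :
    HasFDerivAt (fun y ↦ f ((extChartAt 𝓘(ℝ, E) x₀).symm y))
      (fderiv ℝ (fun y ↦ f ((extChartAt 𝓘(ℝ, E) x₀).symm y)) y) y :=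
  (((contDiffOn_comp_symm hf x₀).contDiffAt
    ((isOpen_extChartAt_target x₀).mem_nhds hy)).differentiableAt one_ne_zero).hasFDerivAt

variable [FiniteDimensional ℝ E] [RiemannianBundle (fun x : M ↦ TangentSpace 𝓘(ℝ, E) x)]

lemma inner_riemannianGradient_chartVector {f : M → ℝ} (hf : ContMDiff 𝓘(ℝ, E) 𝓘(ℝ, ℝ) 1 f)
    {x₀ : M} {y : E} (hy : y ∈ (extChartAt 𝓘(ℝ, E) x₀).target) (v : E) :
    inner ℝ (riemannianGradient f ((extChartAt 𝓘(ℝ, E) x₀).symm y)) (chartVector x₀ y v)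
      = fderiv ℝ (fun y ↦ f ((extChartAt 𝓘(ℝ, E) x₀).symm y)) y v := by
  rw [inner_riemannianGradient]
  let T : E →L[ℝ] ℝ := mfderiv 𝓘(ℝ, E) 𝓘(ℝ, ℝ) f ((extChartAt 𝓘(ℝ, E) x₀).symm y)
  let A : E →L[ℝ] E := mfderiv 𝓘(ℝ, E) 𝓘(ℝ, E) (extChartAt 𝓘(ℝ, E) x₀).symm y
  have h1 : HasMFDerivAt 𝓘(ℝ, E) 𝓘(ℝ, ℝ) (fun y ↦ f ((extChartAt 𝓘(ℝ, E) x₀).symm y)) y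
      (T.comp A) :=
    ((hf.mdifferentiable one_ne_zero) ((extChartAt 𝓘(ℝ, E) x₀).symm y)).hasMFDerivAt.comp y
      (mdifferentiableAt_extChartAt_symm' hy).hasMFDerivAt
  have h2 : HasFDerivAt (fun y ↦ f ((extChartAt 𝓘(ℝ, E) x₀).symm y)) (T.comp A) y :=
    hasMFDerivAt_iff_hasFDerivAt.1 h1
  exact congrArg (fun T : E →L[ℝ] ℝ ↦ T v) (h2.unique (hasFDerivAt_comp_symm hf hy))

end ChartFunction

/-! ### Descent along short geodesics -/

section Descent

variable {E : Type*} [NormedAddCommGroup E] [NormedSpace ℝ E] [FiniteDimensional ℝ E]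
  {M : Type*} [EMetricSpace M] [ChartedSpace E M] [IsManifold 𝓘(ℝ, E) 1 M]
  [RiemannianBundle (fun x : M ↦ TangentSpace 𝓘(ℝ, E) x)] [IsRiemannianManifold 𝓘(ℝ, E) M]
  {lam K : ℝ} {B : Set E}

/-- Along a short geodesic, the derivative of `f` increases by at most `Lf` times the squared
length. -/
lemma fderiv_le_of_gradientLipschitzWith {f : M → ℝ} (hf : ContMDiff 𝓘(ℝ, E) 𝓘(ℝ, ℝ) 1 f)
    {Lf : ℝ} (hgrad : GradientLipschitzWith (E := E) Lf f) {x₀ : M} (hB : IsOpen B)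
    (hBt : B ⊆ (extChartAt 𝓘(ℝ, E) x₀).target)
    (hG : MetricBounds (chartMetric x₀) B lam K)
    (hG' : ContinuousOn (fderiv ℝ (chartMetric x₀)) B) {ρ : ENNReal} (hρ' : ρ ≠ ⊤)
    (hρ : ∀ q : M, edist x₀ q < ρ → q ∈ (extChartAt 𝓘(ℝ, E) x₀).source ∧
      extChartAt 𝓘(ℝ, E) x₀ q ∈ B)
    {c u : ℝ → E} (hcB : ∀ t ∈ Icc (0 : ℝ) 1, c t ∈ B)
    (hc : ∀ t ∈ Icc (0 : ℝ) 1, HasDerivWithinAt c (u t) (Icc 0 1) t)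
    (hu : IsParallelField (chartMetric x₀) c u u) {m : ℝ} (hm : 0 ≤ m)
    (hmK : m * (4 * K ^ 2 + 2 * K * lam) ≤ lam ^ 2) (hmK' : 3 * K / (2 * lam) * m ≤ 1 / 2)
    (hum : ∀ t ∈ Icc (0 : ℝ) 1, ‖u t‖ ≤ m)
    (hlen : edist x₀ ((extChartAt 𝓘(ℝ, E) x₀).symm (c 0))
      + ENNReal.ofReal ‖chartVector x₀ (c 0) (u 0)‖ ≤ ρ) :
    fderiv ℝ (fun y ↦ f ((extChartAt 𝓘(ℝ, E) x₀).symm y)) (c 1) (u 1)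
      ≤ fderiv ℝ (fun y ↦ f ((extChartAt 𝓘(ℝ, E) x₀).symm y)) (c 0) (u 0)
        + Lf * ‖chartVector x₀ (c 0) (u 0)‖ ^ 2 := by
  have h0 : (0 : ℝ) ∈ Icc (0 : ℝ) 1 := left_mem_Icc.2 zero_le_one
  have h1 : (1 : ℝ) ∈ Icc (0 : ℝ) 1 := right_mem_Icc.2 zero_le_one
  obtain ⟨hmin, hdist⟩ :=
    isMinimizingGeodesic_symm_comp hB hBt hG hρ' hρ hcB hc hu hm hmK hum hlen
  have hK := hG.pos
  have hlam := hG.lam_pos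
  obtain ⟨w, hw0, hw⟩ := exists_parallelField hG hG' hcB
    (fun t ht ↦ (hc t ht).continuousWithinAt)
    (fun t ht ↦ (hu t ht).choose_spec.1.continuousWithinAt)
    (fun t ht ↦ le_trans (by gcongr; exact hum t ht) hmK')
    (mfderiv 𝓘(ℝ, E) 𝓘(ℝ, E) (extChartAt 𝓘(ℝ, E) x₀) ((extChartAt 𝓘(ℝ, E) x₀).symm (c 0))
      (riemannianGradient f ((extChartAt 𝓘(ℝ, E) x₀).symm (c 0))))
  have hV0 : chartVector x₀ (c 0) (w 0)
      = riemannianGradient f ((extChartAt 𝓘(ℝ, E) x₀).symm (c 0)) := by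
    rw [hw0]
    exact chartVector_mfderiv_extChartAt (hBt (hcB 0 h0)) _
  have hpt := hgrad _ hmin (chartVector x₀ (c 1) (w 1))
    ⟨fun t ↦ chartVector x₀ (c t) (w t),
      isParallelAlong_symm_comp hBt hG hcB hc hw fun _ _ ↦ rfl, hV0, rfl⟩
  rw [hdist, ENNReal.toReal_ofReal (norm_nonneg _)] at hpt
  rw [← inner_riemannianGradient_chartVector hf (hBt (hcB 0 h0)),
    ← inner_riemannianGradient_chartVector hf (hBt (hcB 1 h1)), ← hV0, ← coordMetric_eq_inner,
    ← chartMetric_apply, ← hw.inner_const hG hB hc hcB hu h1, chartMetric_apply,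
    coordMetric_eq_inner]
  have hnorm : ‖chartVector x₀ (c 1) (u 1)‖ = ‖chartVector x₀ (c 0) (u 0)‖ := by
    rw [← sq_eq_sq₀ (norm_nonneg _) (norm_nonneg _), ← chartMetric_self, ← chartMetric_self]
    exact hu.inner_const hG hB hc hcB hu h1
  have h2 := (abs_le.1 (abs_real_inner_le_norm (chartVector x₀ (c 1) (w 1)
    - riemannianGradient f ((extChartAt 𝓘(ℝ, E) x₀).symm (c 1)))
    (chartVector x₀ (c 1) (u 1)))).1
  rw [inner_sub_left, hnorm] at h2
  have h3 := mul_le_mul_of_nonneg_right hpt (norm_nonneg (chartVector x₀ (c 0) (u 0)))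
  linarith

/-- The descent inequality along a short geodesic. -/
lemma geodesic_descent {f : M → ℝ} (hf : ContMDiff 𝓘(ℝ, E) 𝓘(ℝ, ℝ) 1 f)
    {Lf : ℝ} (hLf : 0 ≤ Lf) (hgrad : GradientLipschitzWith (E := E) Lf f) {x₀ : M} (hB : IsOpen B)
    (hBt : B ⊆ (extChartAt 𝓘(ℝ, E) x₀).target)
    (hG : MetricBounds (chartMetric x₀) B lam K)
    (hG' : ContinuousOn (fderiv ℝ (chartMetric x₀)) B) {ρ : ENNReal} (hρ' : ρ ≠ ⊤)
    (hρ : ∀ q : M, edist x₀ q < ρ → q ∈ (extChartAt 𝓘(ℝ, E) x₀).source ∧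
      extChartAt 𝓘(ℝ, E) x₀ q ∈ B)
    {c u : ℝ → E} (hcB : ∀ t ∈ Icc (0 : ℝ) 1, c t ∈ B)
    (hc : ∀ t ∈ Icc (0 : ℝ) 1, HasDerivWithinAt c (u t) (Icc 0 1) t)
    (hu : IsParallelField (chartMetric x₀) c u u) {m : ℝ} (hm : 0 ≤ m)
    (hmK : m * (4 * K ^ 2 + 2 * K * lam) ≤ lam ^ 2) (hmK' : 3 * K / (2 * lam) * m ≤ 1 / 2)
    (hum : ∀ t ∈ Icc (0 : ℝ) 1, ‖u t‖ ≤ m)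
    (hlen : edist x₀ ((extChartAt 𝓘(ℝ, E) x₀).symm (c 0))
      + ENNReal.ofReal ‖chartVector x₀ (c 0) (u 0)‖ ≤ ρ) :
    f ((extChartAt 𝓘(ℝ, E) x₀).symm (c 1)) ≤ f ((extChartAt 𝓘(ℝ, E) x₀).symm (c 0))
      + fderiv ℝ (fun y ↦ f ((extChartAt 𝓘(ℝ, E) x₀).symm y)) (c 0) (u 0)
        + Lf * ‖chartVector x₀ (c 0) (u 0)‖ ^ 2 := by
  set F : E → ℝ := fun y ↦ f ((extChartAt 𝓘(ℝ, E) x₀).symm y) with hF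
  have hFd : ∀ t ∈ Icc (0 : ℝ) 1,
      HasDerivWithinAt (fun t ↦ F (c t)) (fderiv ℝ F (c t) (u t)) (Icc 0 1) t := fun t ht ↦
    (hasFDerivAt_comp_symm hf (hBt (hcB t ht))).comp_hasDerivWithinAt t (hc t ht)
  obtain ⟨s, hs, hs'⟩ := exists_hasDerivAt_eq_slope (fun t ↦ F (c t))
    (fun t ↦ fderiv ℝ F (c t) (u t)) zero_lt_one (fun t ht ↦ (hFd t ht).continuousWithinAt)
    fun t ht ↦ (hFd t ⟨ht.1.le, ht.2.le⟩).hasDerivAt (Icc_mem_nhds ht.1 ht.2)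
  have hsI : s ∈ Icc (0 : ℝ) 1 := ⟨hs.1.le, hs.2.le⟩
  have hmaps : MapsTo (fun t : ℝ ↦ s * t) (Icc 0 1) (Icc 0 1) := fun t ht ↦
    ⟨mul_nonneg hsI.1 ht.1, mul_le_one₀ hsI.2 ht.1 ht.2⟩
  have hnorm : ‖chartVector x₀ (c (s * 0)) (s • u (s * 0))‖
      = s * ‖chartVector x₀ (c 0) (u 0)‖ := by
    rw [mul_zero, chartVector_smul, norm_smul, Real.norm_of_nonneg hsI.1]
  have hle : s * ‖chartVector x₀ (c 0) (u 0)‖ ≤ ‖chartVector x₀ (c 0) (u 0)‖ :=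
    mul_le_of_le_one_left (norm_nonneg _) hsI.2
  have key := fderiv_le_of_gradientLipschitzWith (c := fun t ↦ c (s * t))
    (u := fun t ↦ s • u (s * t)) hf hgrad hB hBt hG hG' hρ' hρ
    (fun t ht ↦ hcB _ (hmaps ht))
    (fun t ht ↦ (hc _ (hmaps ht)).scomp t
      (by simpa using ((hasDerivAt_id t).const_mul s).hasDerivWithinAt) hmaps)
    (hu.comp_mul hsI) hm hmK hmK' (fun t ht ↦ ?_) ?_
  · rw [hnorm] at key
    simp only [mul_zero, mul_one] at key
    rw [map_smul, map_smul, smul_eq_mul, smul_eq_mul] at key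
    have h1 : fderiv ℝ F (c s) (u s) ≤ fderiv ℝ F (c 0) (u 0)
        + Lf * s * ‖chartVector x₀ (c 0) (u 0)‖ ^ 2 := by
      refine le_of_mul_le_mul_left ?_ hs.1
      linarith
    have h2 : Lf * s * ‖chartVector x₀ (c 0) (u 0)‖ ^ 2
        ≤ Lf * 1 * ‖chartVector x₀ (c 0) (u 0)‖ ^ 2 := by gcongr; exact hsI.2
    simp only [sub_zero, div_one] at hs'
    change F (c 1) ≤ F (c 0) + _ + _
    linarith
  · rw [norm_smul, Real.norm_of_nonneg hsI.1]
    exact (mul_le_of_le_one_left (norm_nonneg _) hsI.2).trans (hum _ (hmaps ht))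
  · rw [hnorm]
    simp only [mul_zero]
    exact le_trans (by gcongr) hlen

end Descent

/-! ### Retractions in a chart -/

section Retraction

variable {E : Type*} [NormedAddCommGroup E] [NormedSpace ℝ E]
  {M : Type*} [TopologicalSpace M] [ChartedSpace E M] [IsManifold 𝓘(ℝ, E) ∞ M]

/-- A retraction in the chart at `x₀`, as a map of the coordinates of a point and of a tangent
vector at this point. -/
def chartRetraction (R : TangentBundle 𝓘(ℝ, E) M → M) (x₀ : M) (z : E × E) : E :=
  extChartAt 𝓘(ℝ, E) x₀ (R ⟨(extChartAt 𝓘(ℝ, E) x₀).symm z.1, chartVector x₀ z.1 z.2⟩)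

variable {R : TangentBundle 𝓘(ℝ, E) M → M}

lemma IsRetraction.map_chartVector_zero (hR : IsRetraction 2 R) (x₀ : M) (y : E) :
    R ⟨(extChartAt 𝓘(ℝ, E) x₀).symm y, chartVector x₀ y 0⟩
      = (extChartAt 𝓘(ℝ, E) x₀).symm y := by
  have h : chartVector x₀ y 0 = 0 :=
    _root_.map_zero (mfderiv 𝓘(ℝ, E) 𝓘(ℝ, E) (extChartAt 𝓘(ℝ, E) x₀).symm y)
  rw [h]
  exact hR.map_zero _

lemma IsRetraction.contMDiffAt_chartVector (hR : IsRetraction 2 R) {x₀ : M} {z : E × E}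
    (hz : z.1 ∈ (extChartAt 𝓘(ℝ, E) x₀).target) :
    ContMDiffAt 𝓘(ℝ, E × E) 𝓘(ℝ, E) 2
      (fun z : E × E ↦ R ⟨(extChartAt 𝓘(ℝ, E) x₀).symm z.1, chartVector x₀ z.1 z.2⟩) z := by
  have h1 : ContMDiffAt 𝓘(ℝ, E × E) 𝓘(ℝ, E).tangent 2 (fun z : E × E ↦
      (⟨(extChartAt 𝓘(ℝ, E) x₀).symm z.1, chartVector x₀ z.1 z.2⟩ :
        TangentBundle 𝓘(ℝ, E) M)) z :=
    ((contMDiffOn_chartVector_prod x₀).contMDiffAt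
      (((isOpen_extChartAt_target x₀).preimage continuous_fst).mem_nhds hz)).of_le (by norm_cast)
  exact (hR.contMDiff _).comp z h1

lemma IsRetraction.contDiffAt_chartRetraction (hR : IsRetraction 2 R) (x₀ : M) :
    ContDiffAt ℝ 2 (chartRetraction R x₀) (extChartAt 𝓘(ℝ, E) x₀ x₀, 0) := by
  have h1 := hR.contMDiffAt_chartVector (x₀ := x₀) (z := (extChartAt 𝓘(ℝ, E) x₀ x₀, 0))
    (mem_extChartAt_target x₀)
  have h2 : ContMDiffAt 𝓘(ℝ, E) 𝓘(ℝ, E) 2 (extChartAt 𝓘(ℝ, E) x₀)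
      (R ⟨(extChartAt 𝓘(ℝ, E) x₀).symm (extChartAt 𝓘(ℝ, E) x₀ x₀),
        chartVector x₀ (extChartAt 𝓘(ℝ, E) x₀ x₀) 0⟩) := by
    rw [hR.map_chartVector_zero, extChartAt_to_inv]
    exact contMDiffAt_extChartAt.of_le (by norm_cast)
  exact (ContMDiffAt.comp (I' := 𝓘(ℝ, E)) (g := extChartAt 𝓘(ℝ, E) x₀)
    (extChartAt 𝓘(ℝ, E) x₀ x₀, (0 : E)) h2 h1).contDiffAt

lemma IsRetraction.fderiv_chartRetraction (hR : IsRetraction 2 R) {x₀ : M} {y : E}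
    (hy : y ∈ (extChartAt 𝓘(ℝ, E) x₀).target)
    (hd : DifferentiableAt ℝ (chartRetraction R x₀) (y, 0)) (v : E) :
    fderiv ℝ (chartRetraction R x₀) (y, 0) (0, v) = v := by
  have : IsManifold 𝓘(ℝ, E) 1 M := IsManifold.of_le (n := ∞) (by norm_num)
  set x := (extChartAt 𝓘(ℝ, E) x₀).symm y with hx
  have hxs : x ∈ (chartAt E x₀).source := by
    rw [← extChartAt_source 𝓘(ℝ, E)]
    exact (extChartAt 𝓘(ℝ, E) x₀).map_target hy
  let A : E →L[ℝ] E := mfderiv 𝓘(ℝ, E) 𝓘(ℝ, E) (extChartAt 𝓘(ℝ, E) x₀).symm y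
  have hR0 : HasMFDerivAt 𝓘(ℝ, E) 𝓘(ℝ, E) (fun v : E ↦ R ⟨x, v⟩) (A 0)
      (ContinuousLinearMap.id ℝ E) := by
    rw [_root_.map_zero]; exact hR.hasMFDerivAt x
  have hA : HasMFDerivAt 𝓘(ℝ, E) 𝓘(ℝ, E) A 0 A := A.hasMFDerivAt
  have h1 := hR0.comp (0 : E) hA
  have hRx : R ⟨x, A 0⟩ = x := by
    rw [_root_.map_zero]; exact hR.map_zero x
  have h2 : HasMFDerivAt 𝓘(ℝ, E) 𝓘(ℝ, E) (extChartAt 𝓘(ℝ, E) x₀) (R ⟨x, A 0⟩)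
      (mfderiv 𝓘(ℝ, E) 𝓘(ℝ, E) (extChartAt 𝓘(ℝ, E) x₀) x : E →L[ℝ] E) := by
    rw [hRx]
    exact (mdifferentiableAt_extChartAt hxs).hasMFDerivAt
  have h3 := (h2.comp (0 : E) h1).hasFDerivAt
  have h4 : HasFDerivAt (fun v : E ↦ (y, v)) (ContinuousLinearMap.inr ℝ E E) 0 :=
    hasFDerivAt_prodMk_right y 0
  have h5 := hd.hasFDerivAt.comp (0 : E) h4
  have h6 := congrArg (fun T : E →L[ℝ] E ↦ T v) (h5.unique h3)
  refine h6.trans ?_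
  exact mfderiv_extChartAt_chartVector hy v

/-- A retraction agrees to second order with the addition, uniformly near a point. -/
lemma IsRetraction.exists_norm_chartRetraction_sub_le (hR : IsRetraction 2 R) (x₀ : M) :
    ∃ δ > 0, ∃ C > 0, ∀ y ∈ Metric.ball (extChartAt 𝓘(ℝ, E) x₀ x₀) δ, ∀ v : E, ‖v‖ < δ →
      ‖chartRetraction R x₀ (y, v) - y - v‖ ≤ C * ‖v‖ ^ 2 := by
  obtain ⟨r, hr, C, hC, -, h⟩ := exists_ball_taylor (hR.contDiffAt_chartRetraction x₀)
  obtain ⟨s, hs, hst⟩ := Metric.mem_nhds_iff.1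
    ((isOpen_extChartAt_target (I := 𝓘(ℝ, E)) x₀).mem_nhds (mem_extChartAt_target x₀))
  refine ⟨min r s, lt_min hr hs, C, hC, fun y hy v hv ↦ ?_⟩
  have hyr : dist y (extChartAt 𝓘(ℝ, E) x₀ x₀) < r := lt_of_lt_of_le hy (min_le_left _ _)
  have hyt : y ∈ (extChartAt 𝓘(ℝ, E) x₀).target := hst (Metric.ball_subset_ball (min_le_right _ _) hy)
  have m0 : ((y, 0) : E × E) ∈ Metric.ball (extChartAt 𝓘(ℝ, E) x₀ x₀, (0 : E)) r := by
    rw [Metric.mem_ball, Prod.dist_eq, max_lt_iff]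
    exact ⟨hyr, by simpa using hr⟩
  have mv : ((y, v) : E × E) ∈ Metric.ball (extChartAt 𝓘(ℝ, E) x₀ x₀, (0 : E)) r := by
    rw [Metric.mem_ball, Prod.dist_eq, max_lt_iff]
    exact ⟨hyr, by simpa using hv.trans_le (min_le_left _ _)⟩
  obtain ⟨hd, -, h2⟩ := h _ m0
  have h3 := (h2 _ mv).2
  have h4 : chartRetraction R x₀ (y, 0) = y := by
    rw [chartRetraction, hR.map_chartVector_zero]
    exact (extChartAt 𝓘(ℝ, E) x₀).right_inv hyt
  have h5 : ((y, v) : E × E) - (y, 0) = (0, v) := by simp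
  rw [h5, hR.fderiv_chartRetraction hyt hd, h4] at h3
  simpa [Prod.norm_def] using h3

end Retraction

/-! ### The descent inequality for small tangent vectors -/

section Local

lemma eventually_mem_ball_prod {E : Type*} [NormedAddCommGroup E] (p : E) {δ : ℝ} (hδ : 0 < δ) :
    ∀ᶠ z : E × E in nhds (p, 0), z.1 ∈ Metric.ball p δ ∧ ‖z.2‖ < δ := by
  filter_upwards [Metric.ball_mem_nhds (p, (0 : E)) hδ] with z hz
  rw [Metric.mem_ball, Prod.dist_eq, max_lt_iff, dist_zero_right] at hz
  exact hz

variable {E : Type*} [NormedAddCommGroup E] [NormedSpace ℝ E] [FiniteDimensional ℝ E]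
  {M : Type*} [EMetricSpace M] [ChartedSpace E M] [IsManifold 𝓘(ℝ, E) ∞ M]
  [RiemannianBundle (fun x : M ↦ TangentSpace 𝓘(ℝ, E) x)]
  [IsContMDiffRiemannianBundle 𝓘(ℝ, E) ∞ E (fun x : M ↦ TangentSpace 𝓘(ℝ, E) x)]
  [IsRiemannianManifold 𝓘(ℝ, E) M]

/-- The descent inequality for small tangent vectors, in the chart at `x₀`: the retraction is
compared with the geodesic of the same initial velocity, and both are straight lines up to second
order. -/
lemma eventually_descent_chart {R : TangentBundle 𝓘(ℝ, E) M → M} (hR : IsRetraction 2 R)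
    {f : M → ℝ} (hf : ContMDiff 𝓘(ℝ, E) 𝓘(ℝ, ℝ) 1 f) {Lf : ℝ} (hLf : 0 ≤ Lf)
    (hgrad : GradientLipschitzWith (E := E) Lf f) (x₀ : M) :
    ∃ C ≥ 0, ∀ᶠ z : E × E in nhds (extChartAt 𝓘(ℝ, E) x₀ x₀, 0),
      f (R ⟨(extChartAt 𝓘(ℝ, E) x₀).symm z.1, chartVector x₀ z.1 z.2⟩)
        ≤ f ((extChartAt 𝓘(ℝ, E) x₀).symm z.1)
          + fderiv ℝ (fun y ↦ f ((extChartAt 𝓘(ℝ, E) x₀).symm y)) z.1 z.2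
          + C * ‖chartVector x₀ z.1 z.2‖ ^ 2 := by
  have : IsManifold 𝓘(ℝ, E) 1 M := IsManifold.of_le (n := ∞) (by norm_num)
  set p₀ := extChartAt 𝓘(ℝ, E) x₀ x₀ with hp₀
  set F : E → ℝ := fun y ↦ f ((extChartAt 𝓘(ℝ, E) x₀).symm y) with hF
  have htgt : (extChartAt 𝓘(ℝ, E) x₀).target ∈ nhds p₀ :=
    (isOpen_extChartAt_target x₀).mem_nhds (mem_extChartAt_target x₀)
  have hG2 : ContDiffAt ℝ 2 (chartMetric x₀) p₀ :=
    ((contDiffOn_chartMetric x₀).contDiffAt htgt).of_le (by norm_cast)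
  obtain ⟨lam, hlam, hlow⟩ := eventually_le_chartMetric (E := E) x₀
  obtain ⟨r₁, hr₁, K, hK, hG₁, hG₁'⟩ := exists_metricBounds hG2 (chartMetric_symm x₀) hlam hlow
  obtain ⟨CF, t, ht, hFt⟩ :=
    ((contDiffOn_comp_symm hf x₀).contDiffAt htgt).exists_lipschitzOnWith
  obtain ⟨r, hr, hrs⟩ := Metric.mem_nhds_iff.1
    (Filter.inter_mem (Filter.inter_mem (Metric.ball_mem_nhds p₀ hr₁) ht) htgt)
  set B := Metric.ball p₀ r with hB
  have hBt : B ⊆ (extChartAt 𝓘(ℝ, E) x₀).target := fun y hy ↦ (hrs hy).2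
  have hBF : B ⊆ t := fun y hy ↦ (hrs hy).1.2
  have hG : MetricBounds (chartMetric x₀) B lam K := hG₁.mono fun y hy ↦ (hrs hy).1.1
  have hG' : ContinuousOn (fderiv ℝ (chartMetric x₀)) B := hG₁'.mono fun y hy ↦ (hrs hy).1.1
  have hW : (extChartAt 𝓘(ℝ, E) x₀).source ∩ extChartAt 𝓘(ℝ, E) x₀ ⁻¹' B ∈ nhds x₀ :=
    Filter.inter_mem (extChartAt_source_mem_nhds x₀)
      ((continuousAt_extChartAt x₀).preimage_mem_nhds (Metric.ball_mem_nhds _ hr))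
  -- a radius `ρ` such that curves of length less than `ρ` from `x₀` remain in the domain
  obtain ⟨ρ', hρ', hρW⟩ := EMetric.mem_nhds_iff.1 hW
  obtain ⟨ρ, hρ0, hρρ'⟩ := ENNReal.lt_iff_exists_nnreal_btwn.1 hρ'
  have hρ0' : (0 : ℝ) < ρ := by exact_mod_cast hρ0
  have hρ : ∀ q : M, edist x₀ q < ρ → q ∈ (extChartAt 𝓘(ℝ, E) x₀).source ∧
      extChartAt 𝓘(ℝ, E) x₀ q ∈ B := fun q hq ↦
    hρW (by rw [Metric.mem_eball, edist_comm]; exact hq.trans hρρ')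
  -- the bound on velocities under which geodesics minimize and parallel transport exists
  set m : ℝ := min (lam ^ 2 / (4 * K ^ 2 + 2 * K * lam)) (lam / (3 * K)) with hm
  have hm0 : 0 < m := lt_min (by positivity) (by positivity)
  have hmK : m * (4 * K ^ 2 + 2 * K * lam) ≤ lam ^ 2 :=
    (le_div_iff₀ (by positivity)).1 (min_le_left _ _)
  have hmK' : 3 * K / (2 * lam) * m ≤ 1 / 2 := by
    calc 3 * K / (2 * lam) * m ≤ 3 * K / (2 * lam) * (lam / (3 * K)) := by
          gcongr; exact min_le_right _ _
      _ = 1 / 2 := by field_simp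
  obtain ⟨δ₁, hδ₁, hgeo⟩ := exists_geodesic hr hG hG2
  obtain ⟨δ₂, hδ₂, CR, hCR, hret⟩ := hR.exists_norm_chartRetraction_sub_le x₀
  have hnorm : ∀ y ∈ B, ∀ v, ‖chartVector x₀ y v‖ ≤ √K * ‖v‖ := by
    intro y hy v
    have h1 := (Real.le_norm_self _).trans ((chartMetric x₀ y).le_opNorm₂ v v)
    have h2 : ‖chartMetric x₀ y‖ * ‖v‖ * ‖v‖ ≤ K * ‖v‖ * ‖v‖ := by
      gcongr; exact hG.norm_le y hy
    rw [chartMetric_self] at h1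
    refine abs_le_of_sq_le_sq' ?_ (by positivity) |>.2
    rw [mul_pow, Real.sq_sqrt hK.le]
    linarith
  -- the conditions on the point and on the vector
  have ev₁ : ∀ᶠ z : E × E in nhds (p₀, 0),
      R ⟨(extChartAt 𝓘(ℝ, E) x₀).symm z.1, chartVector x₀ z.1 z.2⟩ ∈
        (extChartAt 𝓘(ℝ, E) x₀).source ∩ extChartAt 𝓘(ℝ, E) x₀ ⁻¹' B := by
    have h1 := (hR.contMDiffAt_chartVector (x₀ := x₀) (z := (p₀, 0))
      (mem_extChartAt_target x₀)).continuousAt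
    refine h1.eventually_mem ?_
    rw [hR.map_chartVector_zero, hp₀, extChartAt_to_inv]
    exact hW
  have ev₂ : ∀ᶠ z : E × E in nhds (p₀, 0),
      edist x₀ ((extChartAt 𝓘(ℝ, E) x₀).symm z.1) < ENNReal.ofReal (ρ / 2) := by
    have h1 : ContinuousAt (fun z : E × E ↦ (extChartAt 𝓘(ℝ, E) x₀).symm z.1) (p₀, 0) :=
      ContinuousAt.comp (f := Prod.fst) (x := (p₀, (0 : E))) (continuousAt_extChartAt_symm x₀)
        continuousAt_fst
    have h2 := h1.eventually_mem (s := Metric.eball x₀ (ENNReal.ofReal (ρ / 2))) (by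
      simp only [hp₀]
      rw [extChartAt_to_inv]
      exact Metric.eball_mem_nhds _ (by simpa using hρ0'))
    filter_upwards [h2] with z hz
    rw [edist_comm]
    exact hz
  have ev₃ : ∀ {A : ℝ}, 0 < A → ∀ b : ℝ, ∀ᶠ z : E × E in nhds (p₀, 0), b * ‖z.2‖ < A := by
    intro A hA b
    have h1 : ContinuousAt (fun z : E × E ↦ b * ‖z.2‖) (p₀, 0) := by fun_prop
    exact h1.eventually_lt continuousAt_const (by simpa using hA)
  set Cg := 3 * K / (2 * lam) * (K / lam) with hCg
  refine ⟨CF * (CR + Cg) / lam + Lf, by positivity, ?_⟩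
  filter_upwards [ev₁, ev₂, ev₃ (half_pos hρ0') (√K), ev₃ hm0 √(K / lam),
    eventually_mem_ball_prod p₀ hr, eventually_mem_ball_prod p₀ hδ₁,
    eventually_mem_ball_prod p₀ hδ₂] with z hz₁ hz₂ hz₃ hz₄ hzB hz₅ hz₆
  obtain ⟨y, v⟩ := z
  simp only at hz₁ hz₂ hz₃ hz₄ hzB hz₅ hz₆ ⊢
  obtain ⟨c, u, rfl, rfl, hcB, hc, hu⟩ := hgeo y hz₅.1 v hz₅.2
  have hdesc := geodesic_descent hf hLf hgrad Metric.isOpen_ball hBt hG hG' ENNReal.coe_ne_top hρ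
    hcB hc hu hm0.le hmK hmK'
    (fun t ht ↦ (hG.norm_velocity_le Metric.isOpen_ball hc hcB hu ht).trans hz₄.le) (by
      refine (add_le_add hz₂.le (ENNReal.ofReal_le_ofReal
        ((hnorm _ hzB.1 (u 0)).trans hz₃.le))).trans_eq ?_
      rw [← ENNReal.ofReal_add (by positivity) (by positivity), add_halves,
        ENNReal.ofReal_coe_nnreal])
  have hdist : ‖chartRetraction R x₀ (c 0, u 0) - c 1‖ ≤ (CR + Cg) * ‖u 0‖ ^ 2 := by
    have h1 := hret _ hz₆.1 _ hz₆.2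
    have h2 := hG.norm_geodesic_sub_le Metric.isOpen_ball hc hcB hu
    have h3 := norm_sub_le (chartRetraction R x₀ (c 0, u 0) - c 0 - u 0) (c 1 - c 0 - u 0)
    rw [show chartRetraction R x₀ (c 0, u 0) - c 0 - u 0 - (c 1 - c 0 - u 0)
      = chartRetraction R x₀ (c 0, u 0) - c 1 by abel] at h3
    linarith
  have hFlip := (Real.le_norm_self _).trans (hFt.norm_sub_le (hBF hz₁.2)
    (hBF (hcB 1 (right_mem_Icc.2 zero_le_one))))
  rw [(extChartAt 𝓘(ℝ, E) x₀).left_inv hz₁.1] at hFlip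
  have hlow' : ‖u 0‖ ^ 2 ≤ ‖chartVector x₀ (c 0) (u 0)‖ ^ 2 / lam := by
    rw [le_div_iff₀ hlam, ← chartMetric_self, mul_comm]
    exact hG.lower _ hzB.1 (u 0)
  have h4 : (CF : ℝ) * ‖chartRetraction R x₀ (c 0, u 0) - c 1‖
      ≤ CF * (CR + Cg) / lam * ‖chartVector x₀ (c 0) (u 0)‖ ^ 2 := by
    calc (CF : ℝ) * ‖chartRetraction R x₀ (c 0, u 0) - c 1‖
        ≤ CF * ((CR + Cg) * (‖chartVector x₀ (c 0) (u 0)‖ ^ 2 / lam)) := by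
          gcongr
          exact hdist.trans (by gcongr)
      _ = _ := by ring
  have h5 := hFlip.trans h4
  linarith

/-- The descent inequality for small tangent vectors, uniformly near a point. -/
lemma eventually_descent {R : TangentBundle 𝓘(ℝ, E) M → M} (hR : IsRetraction 2 R)
    {f : M → ℝ} (hf : ContMDiff 𝓘(ℝ, E) 𝓘(ℝ, ℝ) 1 f) {Lf : ℝ} (hLf : 0 ≤ Lf)
    (hgrad : GradientLipschitzWith (E := E) Lf f) (x₀ : M) :
    ∃ r > 0, ∃ C ≥ 0, ∀ᶠ x in nhds x₀, ∀ d : TangentSpace 𝓘(ℝ, E) x, ‖d‖ < r →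
      f (R ⟨x, d⟩) ≤ f x + inner ℝ (riemannianGradient f x) d + C * ‖d‖ ^ 2 := by
  have : IsManifold 𝓘(ℝ, E) 1 M := IsManifold.of_le (n := ∞) (by norm_num)
  obtain ⟨C, hC, hdesc⟩ := eventually_descent_chart hR hf hLf hgrad x₀
  obtain ⟨lam, hlam, hlow⟩ := eventually_le_chartMetric (E := E) x₀
  obtain ⟨δ, hδ, hball⟩ := Metric.mem_nhds_iff.1 hdesc
  refine ⟨√lam * δ, by positivity, C, hC, ?_⟩
  have hx := (continuousAt_extChartAt (I := 𝓘(ℝ, E)) x₀).eventually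
    (hlow.and (Metric.ball_mem_nhds _ hδ))
  filter_upwards [extChartAt_source_mem_nhds (I := 𝓘(ℝ, E)) x₀, hx] with x hxs hx
  obtain ⟨y, hy, rfl⟩ : ∃ y ∈ (extChartAt 𝓘(ℝ, E) x₀).target,
      (extChartAt 𝓘(ℝ, E) x₀).symm y = x :=
    ⟨_, (extChartAt 𝓘(ℝ, E) x₀).map_source hxs, (extChartAt 𝓘(ℝ, E) x₀).left_inv hxs⟩
  rw [(extChartAt 𝓘(ℝ, E) x₀).right_inv hy] at hx
  intro d hd
  obtain ⟨v, rfl⟩ : ∃ v : E, chartVector x₀ y v = d := ⟨_, chartVector_mfderiv_extChartAt hy d⟩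
  have hv : ‖v‖ < δ := by
    have h1 := hx.1 v
    rw [chartMetric_self, ← Real.sq_sqrt hlam.le, ← mul_pow] at h1
    have h2 := (sq_le_sq₀ (by positivity) (norm_nonneg _)).1 h1
    exact lt_of_mul_lt_mul_left (h2.trans_lt hd) (Real.sqrt_nonneg _)
  have hmem : ((y, v) : E × E) ∈ Metric.ball (extChartAt 𝓘(ℝ, E) x₀ x₀, (0 : E)) δ := by
    rw [Metric.mem_ball, Prod.dist_eq, max_lt_iff, dist_zero_right]
    exact ⟨hx.2, hv⟩
  rw [inner_riemannianGradient_chartVector hf hy]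
  exact hball hmem

end Local

end RiemannianDescent

end

theorem proposition1 {E : Type*} [NormedAddCommGroup E] [NormedSpace ℝ E] [FiniteDimensional ℝ E]
    {M : Type*} [EMetricSpace M] [ChartedSpace E M] [IsManifold 𝓘(ℝ, E) ∞ M]
    [RiemannianBundle (fun x : M ↦ TangentSpace 𝓘(ℝ, E) x)]
    [IsContMDiffRiemannianBundle 𝓘(ℝ, E) ∞ E (fun x : M ↦ TangentSpace 𝓘(ℝ, E) x)]
    [IsRiemannianManifold 𝓘(ℝ, E) M] [CompactSpace M]
    (R : TangentBundle 𝓘(ℝ, E) M → M) (hR : RiemannianDescent.IsRetraction 2 R)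
    (f : M → ℝ) (hf : ContMDiff 𝓘(ℝ, E) 𝓘(ℝ, ℝ) 1 f)
    (hgrad : ∃ Lf : ℝ, 0 < Lf ∧ RiemannianDescent.GradientLipschitzWith (E := E) Lf f) :
    ∃ L : ℝ, 0 < L ∧ ∀ (x : M) (d : TangentSpace 𝓘(ℝ, E) x),
      f (R ⟨x, d⟩) ≤
        f x + inner ℝ (RiemannianDescent.riemannianGradient f x) d + L * ‖d‖ ^ 2 := by
  obtain ⟨Lf, hLf, hgrad⟩ := hgrad
  obtain ⟨b, hb⟩ := isCompact_univ.exists_bound_of_continuousOn hf.continuous.continuousOn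
  have hb' : ∀ x, |f x| ≤ |b| := fun x ↦ (hb x (mem_univ x)).trans (le_abs_self b)
  obtain ⟨r, hr, C, hC, hloc⟩ : ∃ r > 0, ∃ C ≥ 0, ∀ x ∈ (univ : Set M),
      ∀ d : TangentSpace 𝓘(ℝ, E) x, ‖d‖ < r →
        f (R ⟨x, d⟩) ≤
          f x + inner ℝ (RiemannianDescent.riemannianGradient f x) d + C * ‖d‖ ^ 2 := by
    refine isCompact_univ.induction_on (p := fun S : Set M ↦ ∃ r > 0, ∃ C ≥ 0, ∀ x ∈ S,
      ∀ d : TangentSpace 𝓘(ℝ, E) x, ‖d‖ < r → f (R ⟨x, d⟩) ≤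
        f x + inner ℝ (RiemannianDescent.riemannianGradient f x) d + C * ‖d‖ ^ 2)
      ⟨1, one_pos, 0, le_rfl, by simp⟩ ?_ ?_ ?_
    · rintro S T hST ⟨r, hr, C, hC, h⟩
      exact ⟨r, hr, C, hC, fun x hx ↦ h x (hST hx)⟩
    · rintro S T ⟨r, hr, C, hC, h⟩ ⟨r', hr', C', hC', h'⟩
      refine ⟨min r r', lt_min hr hr', max C C', le_max_of_le_left hC, ?_⟩
      rintro x (hx | hx) d hd
      · exact (h x hx d (hd.trans_le (min_le_left _ _))).trans (by gcongr; exact le_max_left _ _)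
      · exact (h' x hx d (hd.trans_le (min_le_right _ _))).trans (by gcongr; exact le_max_right _ _)
    · intro x _
      obtain ⟨r, hr, C, hC, h⟩ := RiemannianDescent.eventually_descent hR hf hLf.le hgrad x
      exact ⟨_, mem_nhdsWithin_of_mem_nhds h, r, hr, C, hC, fun x hx ↦ hx⟩
  set A := 2 * |b| + C * (r / 2) ^ 2 with hA
  have hA0 : 0 ≤ A := by positivity
  refine ⟨C + (2 * A + 2 * |b|) / r ^ 2 + 1, by positivity, fun x d ↦ ?_⟩
  have hextra : 0 ≤ (2 * A + 2 * |b|) / r ^ 2 := by positivity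
  rcases lt_or_ge ‖d‖ r with hd | hd
  · refine (hloc x (mem_univ x) d hd).trans ?_
    gcongr
    linarith
  · have hd0 : 0 < ‖d‖ := hr.trans_le hd
    set s := r / (2 * ‖d‖) with hs
    have hs0 : 0 < s := by positivity
    have hsd : ‖s • d‖ = r / 2 := by
      rw [norm_smul, Real.norm_of_nonneg hs0.le, hs]
      field_simp
    -- the local inequality at the rescaled vector `s • d` bounds the gradient
    have h1 := hloc x (mem_univ x) (s • d) (by rw [hsd]; linarith)
    rw [hsd, real_inner_smul_right] at h1
    have h2 := abs_le.1 (hb' x)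
    have h3 := abs_le.1 (hb' (R ⟨x, s • d⟩))
    have h4 := abs_le.1 (hb' (R ⟨x, d⟩))
    set g : ℝ := inner ℝ (RiemannianDescent.riemannianGradient f x) d with hg
    have h5 : -A ≤ s * g := by linarith [h3.1, h2.2]
    have h6 : -(A * (2 * ‖d‖ / r)) ≤ g := by
      have : s * (-(A * (2 * ‖d‖ / r))) ≤ s * g := by
        refine le_trans (le_of_eq ?_) h5
        rw [hs]; field_simp
      exact le_of_mul_le_mul_left this hs0
    have h7 : ‖d‖ / r ≤ ‖d‖ ^ 2 / r ^ 2 := by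
      rw [← div_pow]
      exact le_self_pow₀ ((one_le_div hr).2 hd) two_ne_zero
    have h8 : 1 ≤ ‖d‖ ^ 2 / r ^ 2 := by
      rw [← div_pow]
      exact one_le_pow₀ ((one_le_div hr).2 hd)
    have h9 : A * (2 * ‖d‖ / r) ≤ 2 * A * (‖d‖ ^ 2 / r ^ 2) := by
      calc A * (2 * ‖d‖ / r) = 2 * A * (‖d‖ / r) := by ring
        _ ≤ _ := by gcongr
    have h10 : 2 * |b| ≤ 2 * |b| * (‖d‖ ^ 2 / r ^ 2) := by
      nlinarith [abs_nonneg b]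
    have h11 : (C + (2 * A + 2 * |b|) / r ^ 2 + 1) * ‖d‖ ^ 2
        = C * ‖d‖ ^ 2 + 2 * A * (‖d‖ ^ 2 / r ^ 2) + 2 * |b| * (‖d‖ ^ 2 / r ^ 2) + ‖d‖ ^ 2 := by
      ring
    have h12 : 0 ≤ C * ‖d‖ ^ 2 := by positivity
    rw [h11]
    linarith [h4.2, h2.1, sq_nonneg ‖d‖]
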